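/- Let $\mathbb{T}$ be the unit circle with normalized arc length measure $m$, write $|I|=m(I)$, and let $\mathbb{D}$ be the open unit disk. A nonnegative measurable function $w$ on $\mathbb{T}$, not almost everywhere zero, belongs to $A_2$ if $$[w]_{A_2}=\sup_{I}\Big(\frac1{|I|}\int_I w\,dm\Big)\Big(\frac1{|I|}\int_I w^{-1}\,dm\Big)<\infty,$$ the supremum being over all arcs $I\subset\mathbb{T}$. For $z\in\mathbb{D}$ and $w\in\overline{\mathbb{D}}$ put $P_z(w)=\frac{1-|z|^2}{|1-z\bar w|^2}$, and for a function $f$ on $\mathbb{T}$ let $f(z)=\int_{\mathbb{T}}fP_z\,dm$, $z\in\mathbb{D}$, be its harmonic extension. For $0<h\le 1$ and $\theta_0\in\mathbb{R}$ let $$S=S(\theta_0,h)=\{re^{i\theta}: 1-h\le r<1,\ |\theta-\theta_0|\le h\},$$ and let $I_S\subset\mathbb{T}$ be the arc centered at $e^{i\theta_0}$ with $|I_S|=h$. For $I\subset\mathbb{T}$ write $\mu(I)=\int_I\mu\,dm$. Theorem. Let $\mu,\lambda\in A_2$, and let $\tau$ be a nonnegative measure on $\mathbb{D}$. Let $\lambda\,d\tau$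 be the measure on $\mathbb{D}$ whose density with respect to $\tau$ is the harmonic extension $z\mapsto\lambda(z)$. Then the following are equivalent. (i) There is a finite constant $B$ such that for all $f\in L^2(\mathbb{T},\mu\,dm)$, $$\int_{\mathbb{D}}|f(z)|^2\lambda(z)\,d\tau(z)\le B\int_{\mathbb{T}}|f|^2\mu\,dm.$$ (ii) $\displaystyle\sup_{z\in\mathbb{D}}\frac1{\mu(z)}\|P_z\|_{L^1(\lambda\,d\tau)}=\sup_{z\in\mathbb{D}}\frac1{\mu(z)}\int_{\mathbb{D}}P_z(\zeta)\lambda(\zeta)\,d\tau(\zeta)<\infty.$ (iii) There is a finite constant $D$ such that $\displaystyle\frac{(\lambda\,d\tau)(S)}{\mu(I_S)}<D$ for all sectors $S=S(\theta_0,h)$ with $\theta_0\in\mathbb{R}$, $0<h\le 1$. -/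

import Mathlib

open MeasureTheory
open scoped ENNReal NNReal

noncomputable section

namespace TwoWeight

/-- The unit circle, parametrised as `ℝ / 2πℤ`; the class of `θ` stands for the point `e^{iθ}`. -/
abbrev Torus : Type := AddCircle (2 * Real.pi)

instance factTwoPiPos : Fact (0 < 2 * Real.pi) := ⟨Real.two_pi_pos⟩

/-- Normalised arc length measure on the unit circle. -/
abbrev arcMeasure : Measure Torus := AddCircle.haarAddCircle

/-- The point `e^{iθ}` of the complex plane. -/
def bdryPoint (t : Torus) : ℂ := (AddCircle.toCircle t : ℂ)

theorem bdryPoint_coe (θ : ℝ) :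
    bdryPoint (θ : Torus) = Complex.exp ((θ : ℂ) * Complex.I) := by
  have h : 2 * Real.pi / (2 * Real.pi) * θ = θ := by
    rw [div_self (by positivity), one_mul]
  rw [bdryPoint, AddCircle.toCircle_apply_mk, h, Circle.coe_exp]

/-- The open unit disk. -/
def disk : Set ℂ := Metric.ball 0 1

/-- The kernel `P_z(w) = (1 - |z|²) / |1 - z w̄|²`, for `z` in the open disk and `w` in the closed
disk. For `|w| = 1` it is the usual Poisson kernel. -/
def pKernel (z w : ℂ) : ℝ := (1 - ‖z‖ ^ 2) / ‖1 - z * (starRingEnd ℂ) w‖ ^ 2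

theorem pKernel_eq_poissonKernel (z w : ℂ) (hw : ‖w‖ = 1) :
    pKernel z w = poissonKernel 0 z w := by
  have h : ‖1 - z * (starRingEnd ℂ) w‖ = ‖w - z‖ := by
    have h1 : w * (starRingEnd ℂ) w = 1 := by
      rw [Complex.mul_conj, Complex.normSq_eq_norm_sq, hw]; norm_num
    have h2 : 1 - z * (starRingEnd ℂ) w = (w - z) * (starRingEnd ℂ) w := by
      rw [sub_mul, h1]
    rw [h2, norm_mul, Complex.norm_conj, hw, mul_one]
  simp only [pKernel, poissonKernel, sub_zero, h, hw, one_pow]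

/-- The harmonic extension `f(z) = ∫ f P_z dm` to the disk of a function on the circle. -/
def harmExt {E : Type*} [NormedAddCommGroup E] [NormedSpace ℝ E] (f : Torus → E) (z : ℂ) : E :=
  ∫ t, pKernel z (bdryPoint t) • f t ∂arcMeasure

/-- The arc centred at `e^{iθ}` whose normalised arc length is `l`, for `0 < l ≤ 1`; the distance
on `Torus` is the arc length distance, for which the circle has length `2π`. -/
def arc (θ l : ℝ) : Set Torus := Metric.closedBall (θ : Torus) (Real.pi * l)

/-- The constant `[w]_{A₂}`, the supremum over all arcs `I` of the product of the averages over `I`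
of `w` and of `1 / w` (which is `∞` where `w` vanishes). -/
def a2Const (w : Torus → ℝ) : ℝ≥0∞ :=
  ⨆ (θ : ℝ) (l : ℝ) (_ : 0 < l ∧ l ≤ 1),
    (⨍⁻ t in arc θ l, ENNReal.ofReal (w t) ∂arcMeasure) *
      (⨍⁻ t in arc θ l, (ENNReal.ofReal (w t))⁻¹ ∂arcMeasure)

/-- Muckenhoupt `A₂` weights: nonnegative measurable functions with `[w]_{A₂} < ∞`. The null
function is excluded (in `ℝ≥0∞` the product `0 * ∞` is `0`). -/
structure IsA2Weight (w : Torus → ℝ) : Prop where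
  nonneg : ∀ t, 0 ≤ w t
  aemeasurable : AEMeasurable w arcMeasure
  ne_zero : ¬ w =ᵐ[arcMeasure] 0
  a2Const_lt_top : a2Const w < ∞

/-- The measure `w dm` on the circle. -/
def weightMeasure (w : Torus → ℝ) : Measure Torus :=
  arcMeasure.withDensity (fun t => ENNReal.ofReal (w t))

/-- The measure `λ dτ` on the disk, whose density is the harmonic extension of the weight. The
measures on the disk are the restrictions to it of the measures on the plane. -/
def extMeasure (w : Torus → ℝ) (τ : Measure ℂ) : Measure ℂ :=
  (τ.restrict disk).withDensity (fun z => ENNReal.ofReal (harmExt w z))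

/-- The sector `{r e^{iθ} : 1 - h ≤ r < 1, |θ - θ₀| ≤ h}`, for `0 < h ≤ 1`. -/
def sector (θ₀ h : ℝ) : Set ℂ :=
  {z | ∃ r θ : ℝ, 1 - h ≤ r ∧ r < 1 ∧ |θ - θ₀| ≤ h ∧
    z = (r : ℂ) * Complex.exp ((θ : ℂ) * Complex.I)}

end TwoWeight

end

/-!
Write `W = mu dm` and `V = mu⁻¹ dm` on the circle and `ν = lam dτ` on the disk. The implications form
a cycle.

* Poisson integrals from the embedding: the analytic function `ζ ↦ (1 - |z|²)^{1/2} / (1 - z̄ ζ)` is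
  its own Poisson extension and has squared modulus `P_z` on the closed disk, so the embedding
  inequality for it reads `∫ P_z dν ≤ B mu(z)` (`eLpNorm_pKernel_div_le`).

* Sectors from Poisson integrals: `P_z ≥ 1 / (9 h)` on the sector `S(θ₀, h)` when
  `z = (1 - h) e^{iθ₀}`, so it remains to see that `mu(z)` is at most a multiple of `W(I) / h`. The
  doubling property alone loses a logarithm here. Instead, `P_z` is at most a multiple of `1 / h`
  times the square of the maximal function of the indicator function of `I`, and Muckenhoupt's
  theorem in `L²(W)` applies (`IsA2Density.ofReal_mul_lintegral_pKernel_le`).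

* The embedding from sectors: `|f(z)|` is at most a multiple of the supremum of the averages of `|f|`
  over the balls whose tent contains `z` (`lintegral_pKernel_mul_le`), and such a maximal function
  is bounded from `L²(W)` to `L²(ν)` (`exists_embedding_bound`).

Both uses of maximal functions are instances of
`IsA2Density.lintegral_sq_le_of_le_tentMax_arcMeasure`. It follows Lerner's proof of Muckenhoupt's
theorem: for a ball `B` one has `W(B) V(B) ≤ K m(B)²`, hence the unweighted average of `g` over `B`
is at most `K` times the `W`-average over `B` of `mu⁻¹ M_V(g mu)`. This reduces the unweighted maximal
function to two maximal functions taken with respect to the doubling measures `V` and `W`, and for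
these a Vitali covering argument and interpolation suffice (`lintegral_sq_le_of_le_tentMax`).
-/

noncomputable section

namespace TwoWeight

/-! ### Maximal functions over balls and tents -/

section Maximal

variable {X Y : Type*} [PseudoMetricSpace X] [MeasurableSpace X]

/-- The maximal function of `g`, evaluated at `y`: the supremum of the `W`-averages of `g` over the
balls `B(x, r)`, `0 < r ≤ R`, whose tent `T x r` contains `y`. -/
def tentMax (W : Measure X) (T : X → ℝ → Set Y) (R : ℝ) (g : X → ℝ≥0∞) (y : Y) : ℝ≥0∞ :=
  ⨆ (x : X) (r : ℝ) (_ : (0 < r ∧ r ≤ R) ∧ y ∈ T x r), ⨍⁻ t in Metric.ball x r, g t ∂W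

theorem setLAverage_le_tentMax {W : Measure X} {T : X → ℝ → Set Y} {R : ℝ} {g : X → ℝ≥0∞} {y : Y}
    {x : X} {r : ℝ} (hr : 0 < r) (hR : r ≤ R) (hy : y ∈ T x r) :
    ⨍⁻ t in Metric.ball x r, g t ∂W ≤ tentMax W T R g y :=
  le_iSup_of_le x (le_iSup_of_le r (le_iSup_of_le ⟨⟨hr, hR⟩, hy⟩ le_rfl))

/-- The maximal function over balls containing the point is lower semicontinuous. -/
theorem measurable_tentMax_ball [OpensMeasurableSpace X] (W : Measure X) (R : ℝ) (g : X → ℝ≥0∞) :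
    Measurable (tentMax W Metric.ball R g) := by
  refine measurable_of_Ioi fun s => IsOpen.measurableSet ?_
  have : tentMax W Metric.ball R g ⁻¹' Set.Ioi s =
      ⋃ (x : X) (r : ℝ) (_ : (0 < r ∧ r ≤ R) ∧ s < ⨍⁻ t in Metric.ball x r, g t ∂W),
        Metric.ball x r := by
    ext y
    simp only [tentMax, Set.mem_preimage, Set.mem_Ioi, lt_iSup_iff, Set.mem_iUnion, exists_prop]
    exact ⟨fun ⟨x, r, h1, h2⟩ => ⟨x, r, ⟨h1.1, h2⟩, h1.2⟩,
      fun ⟨x, r, h1, h2⟩ => ⟨x, r, ⟨h1.1, h2⟩, h1.2⟩⟩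
  rw [this]
  exact isOpen_iUnion fun x => isOpen_iUnion fun r => isOpen_iUnion fun _ => Metric.isOpen_ball

variable [MeasurableSpace Y] [OpensMeasurableSpace X]
  [TopologicalSpace.SeparableSpace X]

/-- The covering argument behind the weak type estimate. A Vitali subfamily of the balls attached
to the points of `A` is disjoint, and the tents of its five-fold dilates cover `A`. -/
theorem mul_measure_le_lintegral_of_tents {W : Measure X} {ν : Measure Y} {T : X → ℝ → Set Y}
    {C : ℝ≥0} {R : ℝ}
    (hT : ∀ x x' r r', (Metric.ball x r ∩ Metric.ball x' r').Nonempty → r' ≤ 2 * r →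
      T x' r' ⊆ T x (5 * r))
    (hν : ∀ x r, 0 < r → ν (T x (5 * r)) ≤ C * W (Metric.ball x r))
    {A : Set Y} {c : ℝ≥0∞} {h : X → ℝ≥0∞}
    (hA : ∀ y ∈ A, ∃ x r, (0 < r ∧ r ≤ R) ∧ y ∈ T x r ∧
      c * W (Metric.ball x r) ≤ ∫⁻ t in Metric.ball x r, h t ∂W) :
    c * ν A ≤ C * ∫⁻ t, h t ∂W := by
  rcases A.eq_empty_or_nonempty with rfl | ⟨y₀, hy₀⟩
  · simp
  have : Nonempty X := ⟨(hA y₀ hy₀).choose⟩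
  choose! x r hr hy hc using hA
  obtain ⟨u, huA, hdisj, hcov⟩ := Vitali.exists_disjoint_subfamily_covering_enlargement
    (fun y => Metric.ball (x y) (r y)) A r 2 one_lt_two (fun y h => (hr y h).1.le) R
    (fun y h => (hr y h).2) (fun y h => Metric.nonempty_ball.2 (hr y h).1)
  have hcount : u.Countable := hdisj.countable_of_isOpen (fun _ _ => Metric.isOpen_ball)
    (fun y h => Metric.nonempty_ball.2 (hr y (huA h)).1)
  have hsub : A ⊆ ⋃ b ∈ u, T (x b) (5 * r b) := by
    intro a ha
    obtain ⟨b, hb, hne, hle⟩ := hcov a ha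
    refine Set.mem_biUnion hb (hT _ _ _ _ ?_ hle (hy a ha))
    rwa [Set.inter_comm]
  have := hcount.to_subtype
  calc c * ν A ≤ c * ∑' b : u, ν (T (x b) (5 * r b)) := by
        gcongr
        exact (measure_mono hsub).trans (measure_biUnion_le ν hcount _)
    _ ≤ c * ∑' b : u, C * W (Metric.ball (x b) (r b)) := by
        gcongr with b
        exact hν _ _ (hr b (huA b.2)).1
    _ = C * ∑' b : u, c * W (Metric.ball (x b) (r b)) := by
        rw [← ENNReal.tsum_mul_left, ← ENNReal.tsum_mul_left]
        congr 1 with b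
        ring
    _ ≤ C * ∑' b : u, ∫⁻ t in Metric.ball (x b) (r b), h t ∂W := by
        gcongr with b
        exact hc b (huA b.2)
    _ = C * ∫⁻ t in ⋃ b ∈ u, Metric.ball (x b) (r b), h t ∂W := by
        rw [lintegral_biUnion hcount (fun _ _ => Metric.isOpen_ball.measurableSet) hdisj]
    _ ≤ C * ∫⁻ t, h t ∂W := by
        gcongr
        exact Measure.restrict_le_self

/-- Weak type estimate, in the truncated form used for interpolation: averages exceeding `s` are
due to the part of `g` above height `s / 2`. -/
theorem measure_lt_tentMax_le {W : Measure X} [IsFiniteMeasure W] {ν : Measure Y}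
    {T : X → ℝ → Set Y} {C : ℝ≥0} {R : ℝ}
    (hT : ∀ x x' r r', (Metric.ball x r ∩ Metric.ball x' r').Nonempty → r' ≤ 2 * r →
      T x' r' ⊆ T x (5 * r))
    (hν : ∀ x r, 0 < r → ν (T x (5 * r)) ≤ C * W (Metric.ball x r))
    {g : X → ℝ≥0∞} (hg : Measurable g) {s : ℝ≥0∞} (hs : s ≠ ∞) :
    s * ν {y | s < tentMax W T R g y} ≤ 2 * C * ∫⁻ t in {t | s / 2 < g t}, g t ∂W := by
  have hm : MeasurableSet {t | s / 2 < g t} := measurableSet_lt measurable_const hg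
  have key : s / 2 * ν {y | s < tentMax W T R g y} ≤
      C * ∫⁻ t, Set.indicator {t | s / 2 < g t} g t ∂W := by
    refine mul_measure_le_lintegral_of_tents (R := R) hT hν ?_
    intro y hy
    simp only [tentMax, Set.mem_ofPred_eq, lt_iSup_iff] at hy
    obtain ⟨x, r, ⟨hr, hyT⟩, hlt⟩ := hy
    refine ⟨x, r, hr, hyT, ?_⟩
    set B := Metric.ball x r
    have h1 : s * W B ≤ ∫⁻ t in B, g t ∂W := by
      rw [setLAverage_eq] at hlt
      exact ENNReal.mul_le_of_le_div hlt.le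
    have h2 : ∫⁻ t in B, g t ∂W ≤
        (∫⁻ t in B, Set.indicator {t | s / 2 < g t} g t ∂W) + s / 2 * W B := by
      rw [← setLIntegral_const, ← lintegral_add_right _ measurable_const]
      refine lintegral_mono fun t => ?_
      by_cases ht : s / 2 < g t
      · simp [Set.indicator, ht]
      · simpa [Set.indicator, ht] using not_lt.1 ht
    have h3 : s / 2 * W B ≠ ∞ :=
      ENNReal.mul_ne_top (ENNReal.div_ne_top hs two_ne_zero) (measure_ne_top _ _)
    have h4 : s * W B = s / 2 * W B + s / 2 * W B := by rw [← add_mul, ENNReal.add_halves]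
    refine (ENNReal.add_le_add_iff_right h3).1 ?_
    rw [← h4]
    exact h1.trans h2
  rw [lintegral_indicator hm] at key
  calc s * ν {y | s < tentMax W T R g y} = 2 * (s / 2 * ν {y | s < tentMax W T R g y}) := by
        rw [← mul_assoc, ENNReal.mul_div_cancel two_ne_zero ENNReal.ofNat_ne_top]
    _ ≤ 2 * (C * ∫⁻ t in {t | s / 2 < g t}, g t ∂W) := by gcongr
    _ = _ := by ring

/-- Layer cake bound for the square of an extended nonnegative function. -/
theorem lintegral_sq_le_layercake (ν : Measure Y) {F : Y → ℝ≥0∞} (hF : Measurable F) :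
    ∫⁻ y, F y ^ 2 ∂ν ≤
      2 * ∫⁻ s in Set.Ioi (0 : ℝ), ENNReal.ofReal s * ν {y | ENNReal.ofReal s < F y} := by
  have hsup : ∀ y, F y ^ 2 = ⨆ n : ℕ, min (F y) n ^ 2 := by
    intro y
    have hmono : Monotone fun n : ℕ => min (F y) (n : ℝ≥0∞) := fun a b hab =>
      min_le_min le_rfl (by exact_mod_cast hab)
    have h1 : ⨆ n : ℕ, min (F y) (n : ℝ≥0∞) = F y := by
      rw [← inf_iSup_eq, ENNReal.iSup_natCast]
      simp
    refine tendsto_nhds_unique (f := fun n : ℕ => min (F y) (n : ℝ≥0∞) ^ 2) (l := Filter.atTop) ?_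
      (tendsto_atTop_iSup fun a b hab => pow_le_pow_left' (hmono hab) 2)
    have h2 := tendsto_atTop_iSup hmono
    rw [h1] at h2
    exact ENNReal.Tendsto.pow h2
  simp_rw [hsup]
  rw [lintegral_iSup (fun n => (hF.min measurable_const).pow_const 2)
    (fun a b hab y => pow_le_pow_left' (min_le_min le_rfl (by exact_mod_cast hab)) 2)]
  refine iSup_le fun n => ?_
  have hfin : ∀ y, min (F y) (n : ℝ≥0∞) ≠ ∞ := fun y =>
    ((min_le_right _ _).trans_lt (ENNReal.natCast_lt_top n)).ne
  have h := lintegral_rpow_eq_lintegral_meas_lt_mul ν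
    (f := fun y => (min (F y) (n : ℝ≥0∞)).toReal) (Filter.Eventually.of_forall fun y => by simp)
    (hF.min measurable_const).ennreal_toReal.aemeasurable (p := 2) two_pos
  have h0 : ∀ y, min (F y) (n : ℝ≥0∞) ^ 2 =
      ENNReal.ofReal ((min (F y) (n : ℝ≥0∞)).toReal ^ (2 : ℝ)) := by
    intro y
    rw [Real.rpow_ofNat, ENNReal.ofReal_pow ENNReal.toReal_nonneg, ENNReal.ofReal_toReal (hfin y)]
  simp_rw [h0]
  rw [h, ENNReal.ofReal_ofNat]
  gcongr 2 * ?_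
  refine setLIntegral_mono' measurableSet_Ioi fun s hs => ?_
  rw [mul_comm]
  norm_num only [Real.rpow_one]
  gcongr with y
  intro hy
  exact ((ENNReal.ofReal_lt_iff_lt_toReal (le_of_lt hs) (hfin y)).2 hy).trans_le (min_le_left _ _)

/-- The maximal theorem: by interpolation between the weak type estimate and the trivial bound by
the supremum, the maximal function is bounded from `L²(W)` to `L²(ν)` as soon as `ν` of the tents
of dilated balls is controlled by `W` of the balls. -/
theorem lintegral_sq_le_of_le_tentMax {W : Measure X} [IsFiniteMeasure W] {ν : Measure Y}
    {T : X → ℝ → Set Y} {C : ℝ≥0} {R : ℝ}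
    (hT : ∀ x x' r r', (Metric.ball x r ∩ Metric.ball x' r').Nonempty → r' ≤ 2 * r →
      T x' r' ⊆ T x (5 * r))
    (hν : ∀ x r, 0 < r → ν (T x (5 * r)) ≤ C * W (Metric.ball x r))
    {g : X → ℝ≥0∞} (hg : Measurable g) {F : Y → ℝ≥0∞} (hF : Measurable F)
    (hFg : ∀ᵐ y ∂ν, F y ≤ tentMax W T R g y) :
    ∫⁻ y, F y ^ 2 ∂ν ≤ 8 * C * ∫⁻ t, g t ^ 2 ∂W := by
  have hmeas : MeasurableSet {p : ℝ × X | ENNReal.ofReal p.1 / 2 < g p.2} :=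
    measurableSet_lt (by fun_prop) (hg.comp measurable_snd)
  have hvol : ∀ a : ℝ≥0∞, volume ({s : ℝ | ENNReal.ofReal s / 2 < a} ∩ Set.Ioi 0) ≤ 2 * a := by
    intro a
    rcases eq_or_ne a ∞ with rfl | ha
    · simp
    have : {s : ℝ | ENNReal.ofReal s / 2 < a} ∩ Set.Ioi 0 ⊆ Set.Ioo 0 (2 * a.toReal) := by
      rintro s ⟨hs, hs0⟩
      refine ⟨hs0, ?_⟩
      rw [Set.mem_ofPred_eq, ENNReal.div_lt_iff (by simp) (by simp),
        ENNReal.ofReal_lt_iff_lt_toReal (le_of_lt hs0) (by finiteness)] at hs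
      rw [ENNReal.toReal_mul] at hs
      simpa [mul_comm] using hs
    refine (measure_mono this).trans ?_
    rw [Real.volume_Ioo, sub_zero, ENNReal.ofReal_mul two_pos.le, ENNReal.ofReal_toReal ha]
    simp
  calc ∫⁻ y, F y ^ 2 ∂ν
      ≤ 2 * ∫⁻ s in Set.Ioi (0 : ℝ), ENNReal.ofReal s * ν {y | ENNReal.ofReal s < F y} :=
        lintegral_sq_le_layercake ν hF
    _ ≤ 2 * ∫⁻ s in Set.Ioi (0 : ℝ),
          (2 * C * ∫⁻ t in {t | ENNReal.ofReal s / 2 < g t}, g t ∂W) := by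
        gcongr 2 * ?_
        refine lintegral_mono fun s => ?_
        refine le_trans ?_ (measure_lt_tentMax_le (R := R) hT hν hg ENNReal.ofReal_ne_top)
        gcongr ENNReal.ofReal s * ?_
        refine measure_mono_ae ?_
        filter_upwards [hFg] with y hy hlt
        exact lt_of_lt_of_le hlt hy
    _ = 4 * C * ∫⁻ s in Set.Ioi (0 : ℝ), (∫⁻ t in {t | ENNReal.ofReal s / 2 < g t}, g t ∂W) := by
        rw [lintegral_const_mul' _ _ (by finiteness)]
        ring
    _ = 4 * C * ∫⁻ t, (∫⁻ s in Set.Ioi (0 : ℝ),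
          {p : ℝ × X | ENNReal.ofReal p.1 / 2 < g p.2}.indicator (fun p => g p.2) (s, t)) ∂W := by
        rw [← lintegral_lintegral_swap (f := fun s t =>
          {p : ℝ × X | ENNReal.ofReal p.1 / 2 < g p.2}.indicator (fun p => g p.2) (s, t))]
        · congr 2 with s
          rw [← lintegral_indicator (measurableSet_lt measurable_const hg)]
          rfl
        · exact ((hg.comp measurable_snd).indicator hmeas).aemeasurable
    _ ≤ 4 * C * ∫⁻ t, g t * (2 * g t) ∂W := by
        gcongr with t
        calc ∫⁻ s in Set.Ioi (0 : ℝ), {p : ℝ × X | ENNReal.ofReal p.1 / 2 < g p.2}.indicator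
                (fun p => g p.2) (s, t)
            = ∫⁻ s in Set.Ioi (0 : ℝ), {s : ℝ | ENNReal.ofReal s / 2 < g t}.indicator
                (fun _ => g t) s := rfl
          _ = g t * volume ({s : ℝ | ENNReal.ofReal s / 2 < g t} ∩ Set.Ioi 0) := by
              have hms : MeasurableSet {s : ℝ | ENNReal.ofReal s / 2 < g t} :=
                measurableSet_lt (by fun_prop) measurable_const
              rw [lintegral_indicator_const hms, Measure.restrict_apply hms]
          _ ≤ g t * (2 * g t) := by gcongr; exact hvol _
    _ = 8 * C * ∫⁻ t, g t ^ 2 ∂W := by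
        have : ∀ t, g t * (2 * g t) = 2 * g t ^ 2 := fun t => by ring
        simp_rw [this]
        rw [lintegral_const_mul _ (hg.pow_const 2), ← mul_assoc]
        congr 1
        ring

end Maximal

/-! ### The `A₂` condition on balls and the maximal theorem -/

theorem closedBall_ae_eq_ball (x : Torus) (r : ℝ) :
    Metric.closedBall x r =ᵐ[arcMeasure] Metric.ball x r := by
  have h := AddCircle.closedBall_ae_eq_ball (x := x) (ε := r)
  rwa [AddCircle.volume_eq_smul_haarAddCircle,
    Measure.ae_ennreal_smul_measure_eq (by simpa using Real.pi_pos)] at h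

theorem arcMeasure_ball (x : Torus) (r : ℝ) :
    arcMeasure (Metric.ball x r) = ENNReal.ofReal (min 1 (r / Real.pi)) := by
  have h := AddCircle.volume_closedBall (T := 2 * Real.pi) (x := x) r
  have hp := Real.pi_pos
  rw [AddCircle.volume_eq_smul_haarAddCircle, Measure.smul_apply, smul_eq_mul,
    measure_congr (closedBall_ae_eq_ball x r)] at h
  have h2 : min (2 * Real.pi) (2 * r) = 2 * Real.pi * min 1 (r / Real.pi) := by
    rw [mul_min_of_nonneg _ _ (by positivity)]
    congr 1
    · ring
    · field_simp
  rw [h2, ENNReal.ofReal_mul (show 0 ≤ 2 * Real.pi by positivity)] at h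
  exact (ENNReal.mul_right_inj (by simpa using hp) (by finiteness)).1 h

theorem arcMeasure_ball_ne_zero (x : Torus) {r : ℝ} (hr : 0 < r) :
    arcMeasure (Metric.ball x r) ≠ 0 :=
  (Metric.measure_ball_pos _ x hr).ne'

theorem arcMeasure_ball_mul_le (x : Torus) {a r : ℝ} (ha : 1 ≤ a) :
    arcMeasure (Metric.ball x (a * r)) ≤ ENNReal.ofReal a * arcMeasure (Metric.ball x r) := by
  rw [arcMeasure_ball, arcMeasure_ball, ← ENNReal.ofReal_mul (by linarith)]
  refine ENNReal.ofReal_le_ofReal ?_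
  rw [mul_min_of_nonneg _ _ (by linarith)]
  exact min_le_min (by linarith) (by rw [mul_div_assoc])

theorem dist_le_pi (x y : Torus) : dist x y ≤ Real.pi := by
  rw [dist_eq_norm]
  have h := AddCircle.norm_le_half_period (2 * Real.pi) (x := x - y) (by positivity)
  rw [abs_of_pos (by positivity)] at h
  linarith

theorem ball_eq_univ (x : Torus) {r : ℝ} (hr : Real.pi < r) : Metric.ball x r = Set.univ :=
  Set.eq_univ_of_forall fun y => (dist_le_pi y x).trans_lt hr

theorem ball_subset_ball_five_mul {X : Type*} [PseudoMetricSpace X] {x x' : X} {r r' : ℝ}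
    (h : (Metric.ball x r ∩ Metric.ball x' r').Nonempty) (hr : r' ≤ 2 * r) :
    Metric.ball x' r' ⊆ Metric.ball x (5 * r) := by
  obtain ⟨p, hp, hp'⟩ := h
  intro z hz
  rw [Metric.mem_ball] at *
  have := dist_triangle4 z x' p x
  rw [dist_comm x' p] at this
  linarith

/-- The `A₂` condition with constant `K` for a density that is positive and finite everywhere, over
the open balls of the circle. In this form the condition is symmetric in `w` and `w⁻¹`. -/
structure IsA2Density (w : Torus → ℝ≥0∞) (K : ℝ≥0) : Prop where
  measurable : Measurable w
  ne_zero : ∀ t, w t ≠ 0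
  ne_top : ∀ t, w t ≠ ∞
  mul_le : ∀ x r, 0 < r →
    arcMeasure.withDensity w (Metric.ball x r) * arcMeasure.withDensity w⁻¹ (Metric.ball x r) ≤
      K * arcMeasure (Metric.ball x r) ^ 2

namespace IsA2Density

variable {w : Torus → ℝ≥0∞} {K : ℝ≥0}

theorem inv (hw : IsA2Density w K) : IsA2Density w⁻¹ K where
  measurable := hw.measurable.inv
  ne_zero t := ENNReal.inv_ne_zero.2 (hw.ne_top t)
  ne_top t := ENNReal.inv_ne_top.2 (hw.ne_zero t)
  mul_le x r hr := by
    rw [inv_inv, mul_comm]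
    exact hw.mul_le x r hr

/-- Cauchy–Schwarz for `1 = w^{1/2} w^{-1/2}`. -/
theorem sq_arcMeasure_le (hw : IsA2Density w K) {E : Set Torus} (hE : MeasurableSet E) :
    arcMeasure E ^ 2 ≤ arcMeasure.withDensity w E * arcMeasure.withDensity w⁻¹ E := by
  have h := ENNReal.lintegral_mul_le_Lp_mul_Lq (arcMeasure.restrict E)
    (Real.HolderConjugate.two_two) (f := fun t => w t ^ (1 / 2 : ℝ))
    (g := fun t => (w t)⁻¹ ^ (1 / 2 : ℝ)) (hw.measurable.pow_const _).aemeasurable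
    (hw.measurable.inv.pow_const _).aemeasurable
  have h1 : ∀ t, (fun t => w t ^ (1 / 2 : ℝ)) t * (fun t => (w t)⁻¹ ^ (1 / 2 : ℝ)) t = 1 := by
    intro t
    simp only
    rw [← ENNReal.mul_rpow_of_nonneg _ _ (by norm_num),
      ENNReal.mul_inv_cancel (hw.ne_zero t) (hw.ne_top t), ENNReal.one_rpow]
  have h2 : ∀ a : ℝ≥0∞, (a ^ (1 / 2 : ℝ)) ^ (2 : ℝ) = a := fun a => by
    rw [← ENNReal.rpow_mul]; norm_num
  simp only [Pi.mul_apply, h1, h2, lintegral_one, Measure.restrict_apply MeasurableSet.univ,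
    Set.univ_inter] at h
  rw [withDensity_apply _ hE, withDensity_apply _ hE]
  calc arcMeasure E ^ 2 ≤ _ := pow_le_pow_left' h 2
    _ = _ := by
      rw [mul_pow, ← ENNReal.rpow_natCast, ← ENNReal.rpow_natCast]
      norm_num only [h2, Nat.cast_ofNat]
      rfl

theorem withDensity_ball_ne_zero (hw : IsA2Density w K) (x : Torus) {r : ℝ} (hr : 0 < r) :
    arcMeasure.withDensity w (Metric.ball x r) ≠ 0 := by
  intro h
  have h1 := hw.sq_arcMeasure_le (Metric.isOpen_ball (x := x) (ε := r)).measurableSet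
  rw [h, zero_mul] at h1
  exact arcMeasure_ball_ne_zero x hr (by simpa using h1)

theorem isFiniteMeasure (hw : IsA2Density w K) : IsFiniteMeasure (arcMeasure.withDensity w) := by
  have h1 := hw.mul_le 0 4 (by norm_num)
  have h2 := hw.inv.withDensity_ball_ne_zero 0 (r := 4) (by norm_num)
  rw [ball_eq_univ 0 Real.pi_lt_four] at h1 h2
  refine ⟨lt_top_iff_ne_top.2 fun h => ?_⟩
  rw [h, ENNReal.top_mul h2] at h1
  exact (h1.trans_lt (by simp)).ne rfl

theorem withDensity_ball_mul_le (hw : IsA2Density w K) (x : Torus) {a r : ℝ} (ha : 1 ≤ a)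
    (hr : 0 < r) :
    arcMeasure.withDensity w (Metric.ball x (a * r)) ≤
      ENNReal.ofReal a ^ 2 * K * arcMeasure.withDensity w (Metric.ball x r) := by
  have := hw.inv.isFiniteMeasure
  set B := Metric.ball x r
  set B' := Metric.ball x (a * r)
  have hB : B ⊆ B' := Metric.ball_subset_ball (by nlinarith)
  have hM0 : arcMeasure B ^ 2 ≠ 0 := pow_ne_zero 2 (arcMeasure_ball_ne_zero x hr)
  have hMt : arcMeasure B ^ 2 ≠ ∞ := by finiteness
  refine (ENNReal.mul_le_mul_iff_left hM0 hMt).1 ?_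
  calc arcMeasure.withDensity w B' * arcMeasure B ^ 2
      ≤ arcMeasure.withDensity w B' *
          (arcMeasure.withDensity w B * arcMeasure.withDensity w⁻¹ B') := by
        gcongr
        exact (hw.sq_arcMeasure_le Metric.isOpen_ball.measurableSet).trans (by gcongr)
    _ = (arcMeasure.withDensity w B' * arcMeasure.withDensity w⁻¹ B') *
          arcMeasure.withDensity w B := by ring
    _ ≤ (K * (ENNReal.ofReal a * arcMeasure B) ^ 2) * arcMeasure.withDensity w B := by
        gcongr ?_ * _
        refine (hw.mul_le x _ (by positivity)).trans ?_
        gcongr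
        exact arcMeasure_ball_mul_le x ha
    _ = _ := by ring

theorem withDensity_ball_five_mul_le (hw : IsA2Density w K) (x : Torus) {r : ℝ} (hr : 0 < r) :
    arcMeasure.withDensity w (Metric.ball x (5 * r)) ≤
      ((25 * K : ℝ≥0) : ℝ≥0∞) * arcMeasure.withDensity w (Metric.ball x r) := by
  refine (hw.withDensity_ball_mul_le x (by norm_num) hr).trans_eq ?_
  norm_num

theorem lintegral_withDensity (hw : IsA2Density w K) (f : Torus → ℝ≥0∞) :
    ∫⁻ t, f t ∂arcMeasure.withDensity w = ∫⁻ t, w t * f t ∂arcMeasure :=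
  lintegral_withDensity_eq_lintegral_mul_non_measurable _ hw.measurable
    (Filter.Eventually.of_forall fun t => (hw.ne_top t).lt_top) _

theorem setLIntegral_withDensity (hw : IsA2Density w K) {E : Set Torus} (hE : MeasurableSet E)
    (f : Torus → ℝ≥0∞) :
    ∫⁻ t in E, f t ∂arcMeasure.withDensity w = ∫⁻ t in E, w t * f t ∂arcMeasure :=
  setLIntegral_withDensity_eq_setLIntegral_mul_non_measurable _ hw.measurable _ hE
    (Filter.Eventually.of_forall fun t => (hw.ne_top t).lt_top)

theorem mul_inv_cancel_left (hw : IsA2Density w K) (t : Torus) (a : ℝ≥0∞) :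
    w t * ((w t)⁻¹ * a) = a := by
  rw [← mul_assoc, ENNReal.mul_inv_cancel (hw.ne_zero t) (hw.ne_top t), one_mul]

/-- Lerner's pointwise bound: an unweighted average over `B` is at most a `w`-average over `B` of
`w⁻¹` times a maximal function with respect to `w⁻¹`, because
`w(B) w⁻¹(B) ≤ K m(B)²` and the maximal function dominates the `w⁻¹`-average of `g w` over `B`
at every point of `B`. -/
theorem tentMax_arcMeasure_le (hw : IsA2Density w K) {Y : Type*} (T : Torus → ℝ → Set Y) (R : ℝ)
    (g : Torus → ℝ≥0∞) (y : Y) :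
    tentMax arcMeasure T R g y ≤ tentMax (arcMeasure.withDensity w) T R
      (fun t => K * ((w t)⁻¹ * tentMax (arcMeasure.withDensity w⁻¹) Metric.ball R
        (fun s => w s * g s) t)) y := by
  have hW := hw.isFiniteMeasure
  have hV := hw.inv.isFiniteMeasure
  refine iSup_le fun x => iSup_le fun r => iSup_le fun ⟨⟨hr, hR⟩, hy⟩ => ?_
  refine le_trans ?_ (setLAverage_le_tentMax hr hR hy)
  set G := tentMax (arcMeasure.withDensity w⁻¹) Metric.ball R (fun s => w s * g s) with hG
  set B := Metric.ball x r
  have hB : MeasurableSet B := Metric.isOpen_ball.measurableSet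
  have hM0 : arcMeasure B ≠ 0 := arcMeasure_ball_ne_zero x hr
  have hMt : arcMeasure B ≠ ∞ := measure_ne_top _ _
  have hV0 := hw.inv.withDensity_ball_ne_zero x hr
  have hVt : arcMeasure.withDensity w⁻¹ B ≠ ∞ := measure_ne_top _ _
  have hW0 := hw.withDensity_ball_ne_zero x hr
  have hWt : arcMeasure.withDensity w B ≠ ∞ := measure_ne_top _ _
  set a := ∫⁻ t in B, g t ∂arcMeasure with ha
  set b := ∫⁻ t in B, G t ∂arcMeasure with hb
  have h1 : ∫⁻ t in B, w t * g t ∂arcMeasure.withDensity w⁻¹ = a := by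
    rw [hw.inv.setLIntegral_withDensity hB]
    refine lintegral_congr fun t => ?_
    rw [Pi.inv_apply, ← mul_assoc, ENNReal.inv_mul_cancel (hw.ne_zero t) (hw.ne_top t), one_mul]
  have h2 : a / arcMeasure.withDensity w⁻¹ B * arcMeasure B ≤ b := by
    rw [← setLIntegral_const]
    refine setLIntegral_mono' hB fun t ht => ?_
    rw [← h1, ← setLAverage_eq]
    exact setLAverage_le_tentMax hr hR ht
  have h3 : a * arcMeasure B ≤ arcMeasure.withDensity w⁻¹ B * b := by
    calc a * arcMeasure B
        = arcMeasure.withDensity w⁻¹ B * (a / arcMeasure.withDensity w⁻¹ B * arcMeasure B) := by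
          rw [← mul_assoc, ENNReal.mul_div_cancel hV0 hVt]
      _ ≤ _ := by gcongr
  rw [setLAverage_eq, setLAverage_eq, hw.setLIntegral_withDensity hB]
  have h4 : ∫⁻ t in B, w t * (K * ((w t)⁻¹ * G t)) ∂arcMeasure = K * b := by
    rw [hb, ← lintegral_const_mul' _ _ (by finiteness)]
    refine lintegral_congr fun t => ?_
    rw [mul_left_comm, hw.mul_inv_cancel_left]
  rw [h4, ENNReal.div_le_iff hM0 hMt, ENNReal.mul_comm_div, ← mul_div_assoc,
    ENNReal.le_div_iff_mul_le (Or.inl hW0) (Or.inl hWt)]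
  refine (ENNReal.mul_le_mul_iff_left hM0 hMt).1 ?_
  calc a * arcMeasure.withDensity w B * arcMeasure B
      = arcMeasure.withDensity w B * (a * arcMeasure B) := by ring
    _ ≤ arcMeasure.withDensity w B * (arcMeasure.withDensity w⁻¹ B * b) := by gcongr
    _ = (arcMeasure.withDensity w B * arcMeasure.withDensity w⁻¹ B) * b := by ring
    _ ≤ (K * arcMeasure B ^ 2) * b := by gcongr ?_ * _; exact hw.mul_le x r hr
    _ = _ := by ring

/-- The maximal theorem for unweighted averages, from `L²(w)` to `L²(ν)`. With `ν = w dm` and the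
balls themselves as tents it is Muckenhoupt's theorem for `p = 2`. -/
theorem lintegral_sq_le_of_le_tentMax_arcMeasure (hw : IsA2Density w K) {Y : Type*}
    [MeasurableSpace Y] {ν : Measure Y} {T : Torus → ℝ → Set Y} {C : ℝ≥0} {R : ℝ}
    (hT : ∀ x x' r r', (Metric.ball x r ∩ Metric.ball x' r').Nonempty → r' ≤ 2 * r →
      T x' r' ⊆ T x (5 * r))
    (hν : ∀ x r, 0 < r → ν (T x (5 * r)) ≤ C * arcMeasure.withDensity w (Metric.ball x r))
    {g : Torus → ℝ≥0∞} (hg : Measurable g) {F : Y → ℝ≥0∞} (hF : Measurable F)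
    (hFg : ∀ᵐ y ∂ν, F y ≤ tentMax arcMeasure T R g y) :
    ∫⁻ y, F y ^ 2 ∂ν ≤
      ((8 * C * (K ^ 2 * (8 * (25 * K))) : ℝ≥0) : ℝ≥0∞) *
        ∫⁻ t, g t ^ 2 ∂arcMeasure.withDensity w := by
  have hW := hw.isFiniteMeasure
  have hV := hw.inv.isFiniteMeasure
  set G := tentMax (arcMeasure.withDensity w⁻¹) Metric.ball R (fun s => w s * g s) with hG
  have hGm : Measurable G := measurable_tentMax_ball _ _ _
  have h1 := lintegral_sq_le_of_le_tentMax (W := arcMeasure.withDensity w) hT hν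
    (g := fun t => K * ((w t)⁻¹ * G t)) (by have := hw.measurable; fun_prop) hF
    (hFg.mono fun y hy => hy.trans (hw.tentMax_arcMeasure_le T R g y))
  have h2 : ∫⁻ t, (K * ((w t)⁻¹ * G t)) ^ 2 ∂arcMeasure.withDensity w =
      K ^ 2 * ∫⁻ t, G t ^ 2 ∂arcMeasure.withDensity w⁻¹ := by
    rw [hw.lintegral_withDensity, hw.inv.lintegral_withDensity,
      ← lintegral_const_mul' _ _ (by finiteness)]
    refine lintegral_congr fun t => ?_
    calc w t * (K * ((w t)⁻¹ * G t)) ^ 2 = K ^ 2 * (w t * ((w t)⁻¹ * ((w t)⁻¹ * G t ^ 2))) := by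
          ring
      _ = _ := by rw [hw.mul_inv_cancel_left]; rfl
  have h3 : ∫⁻ t, G t ^ 2 ∂arcMeasure.withDensity w⁻¹ ≤
      8 * ((25 * K : ℝ≥0) : ℝ≥0∞) * ∫⁻ t, (w t * g t) ^ 2 ∂arcMeasure.withDensity w⁻¹ := by
    refine lintegral_sq_le_of_le_tentMax (T := Metric.ball) (R := R) ?_ ?_
      (hw.measurable.mul hg) hGm (Filter.Eventually.of_forall fun y => le_rfl)
    · exact fun _ _ _ _ => ball_subset_ball_five_mul
    · exact fun _ _ => hw.inv.withDensity_ball_five_mul_le _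
  have h4 : ∫⁻ t, (w t * g t) ^ 2 ∂arcMeasure.withDensity w⁻¹ =
      ∫⁻ t, g t ^ 2 ∂arcMeasure.withDensity w := by
    rw [hw.lintegral_withDensity, hw.inv.lintegral_withDensity]
    refine lintegral_congr fun t => ?_
    calc (w t)⁻¹ * (w t * g t) ^ 2 = w t * ((w t)⁻¹ * (w t * g t ^ 2)) := by ring
      _ = _ := by rw [hw.mul_inv_cancel_left]
  calc ∫⁻ y, F y ^ 2 ∂ν
      ≤ 8 * C * (K ^ 2 * (8 * ((25 * K : ℝ≥0) : ℝ≥0∞) *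
          ∫⁻ t, g t ^ 2 ∂arcMeasure.withDensity w)) := by
        refine h1.trans ?_
        rw [h2]
        gcongr
        exact h3.trans_eq (by rw [h4])
    _ = _ := by push_cast; ring

end IsA2Density

/-- An `A₂` weight agrees almost everywhere with a positive finite measurable density: finiteness of
the `A₂` product over the whole circle makes both `w` and `1 / w` integrable. -/
theorem IsA2Weight.exists_isA2Density {u : Torus → ℝ} (hu : IsA2Weight u) :
    ∃ (w : Torus → ℝ≥0∞) (K : ℝ≥0), IsA2Density w K ∧
      (fun t => ENNReal.ofReal (u t)) =ᵐ[arcMeasure] w := by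
  have hmeas : AEMeasurable (fun t => ENNReal.ofReal (u t)) arcMeasure :=
    hu.aemeasurable.ennreal_ofReal
  have harc : ∀ x r, 0 < r → r ≤ Real.pi →
      (∫⁻ t in Metric.ball x r, ENNReal.ofReal (u t) ∂arcMeasure) *
        (∫⁻ t in Metric.ball x r, (ENNReal.ofReal (u t))⁻¹ ∂arcMeasure) ≤
      a2Const u * arcMeasure (Metric.ball x r) ^ 2 := by
    intro x r hr hrp
    obtain ⟨θ, rfl⟩ := QuotientAddGroup.mk_surjective x
    have h1 : (⨍⁻ t in arc θ (r / Real.pi), ENNReal.ofReal (u t) ∂arcMeasure) *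
        (⨍⁻ t in arc θ (r / Real.pi), (ENNReal.ofReal (u t))⁻¹ ∂arcMeasure) ≤ a2Const u :=
      le_iSup_of_le θ (le_iSup_of_le (r / Real.pi)
        (le_iSup_of_le ⟨by positivity, (div_le_one Real.pi_pos).2 hrp⟩ le_rfl))
    have h2 : arc θ (r / Real.pi) = Metric.closedBall (θ : Torus) r := by
      rw [arc, mul_div_cancel₀ _ Real.pi_ne_zero]
    rw [h2, setLAverage_congr (closedBall_ae_eq_ball _ _),
      setLAverage_congr (closedBall_ae_eq_ball _ _), setLAverage_eq, setLAverage_eq] at h1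
    have hM0 := arcMeasure_ball_ne_zero (θ : Torus) hr
    have hMt : arcMeasure (Metric.ball (θ : Torus) r) ≠ ∞ := measure_ne_top _ _
    set M := arcMeasure (Metric.ball (θ : Torus) r)
    calc _ = _ := rfl
      _ = ((∫⁻ t in Metric.ball (θ : Torus) r, ENNReal.ofReal (u t) ∂arcMeasure) / M) *
          ((∫⁻ t in Metric.ball (θ : Torus) r, (ENNReal.ofReal (u t))⁻¹ ∂arcMeasure) / M) *
            M ^ 2 := by
          rw [pow_two, mul_mul_mul_comm, ENNReal.div_mul_cancel hM0 hMt,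
            ENNReal.div_mul_cancel hM0 hMt]
      _ ≤ _ := by gcongr
  have hball : ∀ x r, 0 < r →
      (∫⁻ t in Metric.ball x r, ENNReal.ofReal (u t) ∂arcMeasure) *
        (∫⁻ t in Metric.ball x r, (ENNReal.ofReal (u t))⁻¹ ∂arcMeasure) ≤
      a2Const u * arcMeasure (Metric.ball x r) ^ 2 := by
    intro x r hr
    -- Beyond radius `π` every ball is the whole circle.
    rcases le_or_gt r Real.pi with h | h
    · exact harc x r hr h
    · have h1 := harc x Real.pi Real.pi_pos le_rfl
      have h2 : Metric.ball x Real.pi =ᵐ[arcMeasure] Metric.ball x r := by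
        rw [ball_eq_univ x h]
        have h3 : Metric.closedBall x Real.pi = Set.univ :=
          Set.eq_univ_of_forall fun y => dist_le_pi y x
        exact h3 ▸ (closedBall_ae_eq_ball x Real.pi).symm
      rwa [setLIntegral_congr h2, setLIntegral_congr h2, measure_congr h2] at h1
  have hpos : ∀ᵐ t ∂arcMeasure, 0 < u t := by
    have h1 := hball 0 4 (by norm_num)
    rw [ball_eq_univ 0 Real.pi_lt_four, Measure.restrict_univ] at h1
    have h2 : ∫⁻ t, ENNReal.ofReal (u t) ∂arcMeasure ≠ 0 := by
      rw [Ne, lintegral_eq_zero_iff' hmeas]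
      intro h
      refine hu.ne_zero (h.mono fun t ht => ?_)
      exact le_antisymm (by simpa using ht) (hu.nonneg t)
    have h3 : ∫⁻ t, (ENNReal.ofReal (u t))⁻¹ ∂arcMeasure ≠ ∞ := by
      intro h
      rw [h, ENNReal.mul_top h2] at h1
      exact (h1.trans_lt (ENNReal.mul_lt_top hu.a2Const_lt_top (by finiteness))).ne rfl
    filter_upwards [ae_lt_top' hmeas.inv h3] with t ht
    simpa using ht
  -- A measurable representative of `u`, changed to `1` where it is `0` or `∞`.
  set v := hmeas.mk _ with hv
  have hvm : Measurable v := hmeas.measurable_mk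
  set w : Torus → ℝ≥0∞ := fun t => if v t ≠ 0 ∧ v t ≠ ∞ then v t else 1 with hw
  have hwm : Measurable w := by
    refine Measurable.ite ?_ hvm measurable_const
    exact ((measurableSet_eq_fun hvm measurable_const).compl).inter
      ((measurableSet_eq_fun hvm measurable_const).compl)
  have hae : (fun t => ENNReal.ofReal (u t)) =ᵐ[arcMeasure] w := by
    filter_upwards [hmeas.ae_eq_mk, hpos] with t h1 h2
    rw [hw]
    simp only
    rw [if_pos, h1]
    rw [hv, ← h1]
    simpa using h2
  refine ⟨w, (a2Const u).toNNReal, ⟨hwm, ?_, ?_, ?_⟩, hae⟩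
  · intro t
    simp only [hw]
    split_ifs with h
    · exact h.1
    · exact one_ne_zero
  · intro t
    simp only [hw]
    split_ifs with h
    · exact h.2
    · exact ENNReal.one_ne_top
  · intro x r hr
    have hB : MeasurableSet (Metric.ball x r) := Metric.isOpen_ball.measurableSet
    rw [withDensity_apply _ hB, withDensity_apply _ hB,
      ENNReal.coe_toNNReal hu.a2Const_lt_top.ne]
    refine le_trans (le_of_eq ?_) (hball x r hr)
    congr 1 <;> refine lintegral_congr_ae (ae_restrict_of_ae ?_)
    · exact hae.symm
    · filter_upwards [hae] with t ht
      rw [Pi.inv_apply, ← ht]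

/-! ### Estimates for the Poisson kernel -/

theorem norm_bdryPoint (t : Torus) : ‖bdryPoint t‖ = 1 := Circle.norm_coe _

theorem continuous_bdryPoint : Continuous bdryPoint :=
  continuous_subtype_val.comp AddCircle.continuous_toCircle

theorem bdryPoint_mul_conj (y t : Torus) :
    bdryPoint y * (starRingEnd ℂ) (bdryPoint t) = bdryPoint (y - t) := by
  rw [bdryPoint, bdryPoint, bdryPoint, ← Circle.coe_inv_eq_conj, sub_eq_add_neg,
    AddCircle.toCircle_add, AddCircle.toCircle_neg, Circle.coe_mul]

theorem exists_coe_eq_and_norm_eq_abs (s : Torus) :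
    ∃ θ : ℝ, |θ| ≤ Real.pi ∧ (θ : Torus) = s ∧ ‖s‖ = |θ| := by
  obtain ⟨θ, hθ⟩ := (AddCircle.equivIoc (2 * Real.pi) (-Real.pi)).symm.surjective s
  have hle : |(θ : ℝ)| ≤ Real.pi := by
    have := θ.2.2
    exact abs_le.2 ⟨θ.2.1.le, by linarith⟩
  refine ⟨θ, hle, hθ, ?_⟩
  rw [← hθ]
  refine (AddCircle.norm_coe_eq_abs_iff _ Real.two_pi_pos.ne').2 ?_
  rw [abs_of_pos Real.two_pi_pos]
  linarith

/-- Chords are at least `2 / π` times the arcs they subtend. -/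
theorem norm_le_norm_bdryPoint_sub_one (s : Torus) :
    2 / Real.pi * ‖s‖ ≤ ‖bdryPoint s - 1‖ := by
  obtain ⟨θ, hθ, rfl, h1⟩ := exists_coe_eq_and_norm_eq_abs s
  rw [h1, bdryPoint_coe, mul_comm (θ : ℂ), Complex.norm_exp_I_mul_ofReal_sub_one,
    Real.norm_eq_abs, abs_mul, abs_two]
  have h2 := Real.mul_abs_le_abs_sin (x := θ / 2) (by rw [abs_div, abs_two]; linarith)
  rw [abs_div, abs_two] at h2
  linarith

theorem norm_exp_sub_one_le (φ : ℝ) : ‖Complex.exp (φ * Complex.I) - 1‖ ≤ |φ| := by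
  rw [mul_comm]
  exact Real.norm_exp_I_mul_ofReal_sub_one_le

section Kernel

variable {r : ℝ} (y t : Torus)

theorem one_sub_le_norm (hr : 0 ≤ r) :
    1 - r ≤ ‖1 - (r : ℂ) * bdryPoint y * (starRingEnd ℂ) (bdryPoint t)‖ := by
  have h := norm_sub_norm_le (1 : ℂ) ((r : ℂ) * bdryPoint y * (starRingEnd ℂ) (bdryPoint t))
  simpa [norm_bdryPoint, abs_of_nonneg hr] using h

theorem norm_one_sub_le_two (hr : 0 ≤ r) (hr1 : r < 1) :
    ‖1 - (r : ℂ) * bdryPoint y * (starRingEnd ℂ) (bdryPoint t)‖ ≤ 2 := by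
  have h := norm_sub_le (1 : ℂ) ((r : ℂ) * bdryPoint y * (starRingEnd ℂ) (bdryPoint t))
  simp only [norm_mul, norm_bdryPoint, Complex.norm_conj, Complex.norm_real, Real.norm_eq_abs,
    abs_of_nonneg hr, norm_one] at h
  linarith

theorem dist_le_mul_norm (hr : 0 ≤ r) (hr1 : r < 1) :
    dist t y ≤ Real.pi * ‖1 - (r : ℂ) * bdryPoint y * (starRingEnd ℂ) (bdryPoint t)‖ := by
  have h0 := one_sub_le_norm y t hr
  rw [mul_assoc, bdryPoint_mul_conj] at *
  set b := bdryPoint (y - t)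
  have h1 : ‖b - 1‖ ≤ ‖1 - (r : ℂ) * b‖ + (1 - r) := by
    have : b - 1 = -(1 - (r : ℂ) * b) + ((1 - r : ℝ) : ℂ) * b := by push_cast; ring
    rw [this]
    refine (norm_add_le _ _).trans ?_
    rw [norm_neg, norm_mul, norm_bdryPoint, Complex.norm_real, Real.norm_eq_abs,
      abs_of_pos (by linarith), mul_one]
  have h2 := norm_le_norm_bdryPoint_sub_one (y - t)
  rw [dist_comm, dist_eq_norm]
  have h3 : 2 / Real.pi * ‖y - t‖ ≤ 2 * ‖1 - (r : ℂ) * b‖ := by linarith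
  have hp := Real.pi_pos
  rw [div_mul_eq_mul_div, div_le_iff₀ hp] at h3
  linarith

theorem pKernel_le (hr : 0 ≤ r) (hr1 : r < 1) :
    pKernel (r * bdryPoint y) (bdryPoint t) ≤
      2 * (1 - r) / ‖1 - (r : ℂ) * bdryPoint y * (starRingEnd ℂ) (bdryPoint t)‖ ^ 2 := by
  rw [pKernel, norm_mul, norm_bdryPoint, Complex.norm_real, Real.norm_eq_abs, abs_of_nonneg hr]
  gcongr
  nlinarith

/-- The Poisson kernel is dominated by a superposition of normalised indicator functions of
concentric balls, with geometrically decreasing coefficients. -/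
theorem ofReal_pKernel_le_tsum (hr : 0 ≤ r) (hr1 : r < 1) :
    ENNReal.ofReal (pKernel (r * bdryPoint y) (bdryPoint t)) ≤
      ∑' k : ℕ, 32 * 2⁻¹ ^ k * (arcMeasure (Metric.ball y (2 ^ k * (1 - r))))⁻¹ *
        (Metric.ball y (2 ^ k * (1 - r))).indicator 1 t := by
  classical
  have hρ : 0 < 1 - r := by linarith
  have hp := Real.pi_pos
  set L := ‖1 - (r : ℂ) * bdryPoint y * (starRingEnd ℂ) (bdryPoint t)‖ with hL
  have hLρ : 1 - r ≤ L := one_sub_le_norm y t hr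
  have hLd : dist t y ≤ Real.pi * L := dist_le_mul_norm y t hr hr1
  have hex : ∃ k : ℕ, dist t y < 2 ^ k * (1 - r) := by
    obtain ⟨k, hk⟩ := pow_unbounded_of_one_lt (dist t y / (1 - r)) one_lt_two
    exact ⟨k, (div_lt_iff₀ hρ).1 hk⟩
  -- The smallest ball containing `t` already accounts for the kernel at `t`.
  obtain ⟨k, hk, hkL⟩ : ∃ k : ℕ, dist t y < 2 ^ k * (1 - r) ∧
      2 ^ k * (1 - r) ≤ 2 * Real.pi * L := by
    refine ⟨Nat.find hex, Nat.find_spec hex, ?_⟩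
    rcases Nat.eq_zero_or_pos (Nat.find hex) with h0 | h0
    · rw [h0]
      nlinarith [Real.pi_gt_three]
    · have h1 := Nat.find_min hex (Nat.sub_lt h0 one_pos)
      rw [not_lt] at h1
      have h2 : (2 : ℝ) ^ Nat.find hex = 2 * 2 ^ (Nat.find hex - 1) := by
        rw [← pow_succ', Nat.sub_add_cancel h0]
      rw [h2]
      linarith
  refine le_trans ?_ (ENNReal.le_tsum k)
  rw [Set.indicator_of_mem (Metric.mem_ball.2 hk), Pi.one_apply, mul_one, arcMeasure_ball]
  set s := 2 ^ k * (1 - r) with hs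
  have hs0 : 0 < s := by positivity
  have hreal : pKernel (r * bdryPoint y) (bdryPoint t) ≤ 32 * (2⁻¹ ^ k * (s / Real.pi)⁻¹) := by
    refine (pKernel_le y t hr hr1).trans ?_
    have hL0 : 0 < L := hρ.trans_le hLρ
    rw [div_le_iff₀ (by positivity)]
    have h1 : s ^ 2 ≤ 4 * Real.pi ^ 2 * L ^ 2 := by
      have := pow_le_pow_left₀ hs0.le hkL 2
      nlinarith
    have h2 : (2 : ℝ)⁻¹ ^ k * (s / Real.pi)⁻¹ = (1 - r) * Real.pi / s ^ 2 := by
      rw [inv_pow, hs]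
      field_simp
    rw [h2, mul_div_assoc', div_mul_eq_mul_div, le_div_iff₀ (by positivity)]
    have h4 : Real.pi ^ 2 * L ^ 2 ≤ 4 * (Real.pi * L ^ 2) := by
      have := Real.pi_lt_four
      have : 0 ≤ Real.pi * L ^ 2 := by positivity
      nlinarith
    nlinarith
  calc ENNReal.ofReal (pKernel (r * bdryPoint y) (bdryPoint t))
      ≤ ENNReal.ofReal (32 * (2⁻¹ ^ k * (s / Real.pi)⁻¹)) := ENNReal.ofReal_le_ofReal hreal
    _ = 32 * 2⁻¹ ^ k * (ENNReal.ofReal (s / Real.pi))⁻¹ := by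
        rw [ENNReal.ofReal_mul (by norm_num), ENNReal.ofReal_mul (by positivity),
          ENNReal.ofReal_pow (by norm_num), ENNReal.ofReal_inv_of_pos two_pos,
          ENNReal.ofReal_inv_of_pos (by positivity), mul_assoc]
        norm_num
    _ ≤ _ := by
        gcongr
        exact min_le_right _ _

theorem measurable_pKernel : Measurable fun p : ℂ × ℂ => pKernel p.1 p.2 := by
  unfold pKernel
  fun_prop

/-- Poisson integrals are bounded by the averages over the balls centred at the radial projection
whose radius is at least the distance to the circle. -/
theorem lintegral_pKernel_mul_le (hr : 0 ≤ r) (hr1 : r < 1) {g : Torus → ℝ≥0∞}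
    (hg : Measurable g) {M : ℝ≥0∞}
    (hM : ∀ s, 1 - r ≤ s → s ≤ 4 → ⨍⁻ u in Metric.ball y s, g u ∂arcMeasure ≤ M) :
    ∫⁻ u, ENNReal.ofReal (pKernel (r * bdryPoint y) (bdryPoint u)) * g u ∂arcMeasure ≤
      64 * M := by
  have hM' : ∀ k : ℕ, ⨍⁻ u in Metric.ball y (2 ^ k * (1 - r)), g u ∂arcMeasure ≤ M := by
    intro k
    rcases le_or_gt (2 ^ k * (1 - r)) 4 with h | h
    · exact hM _ (le_mul_of_one_le_left (by linarith) (one_le_pow₀ one_le_two)) h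
    · -- Balls of radius more than `4` are the whole circle.
      rw [ball_eq_univ y (Real.pi_lt_four.trans h), ← ball_eq_univ y Real.pi_lt_four]
      exact hM 4 (by linarith) le_rfl
  calc ∫⁻ u, ENNReal.ofReal (pKernel (r * bdryPoint y) (bdryPoint u)) * g u ∂arcMeasure
      ≤ ∫⁻ u, ∑' k : ℕ, 32 * 2⁻¹ ^ k * (arcMeasure (Metric.ball y (2 ^ k * (1 - r))))⁻¹ *
          (Metric.ball y (2 ^ k * (1 - r))).indicator g u ∂arcMeasure := by
        refine lintegral_mono fun u => ?_
        refine (mul_le_mul_left (ofReal_pKernel_le_tsum y u hr hr1) (g u)).trans_eq ?_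
        rw [← ENNReal.tsum_mul_right]
        congr 1 with k
        rw [mul_assoc]
        congr 1
        by_cases hu : u ∈ Metric.ball y (2 ^ k * (1 - r)) <;> simp [hu]
    _ = ∑' k : ℕ, 32 * 2⁻¹ ^ k * ⨍⁻ u in Metric.ball y (2 ^ k * (1 - r)), g u ∂arcMeasure := by
        rw [lintegral_tsum fun k => ((hg.indicator
          Metric.isOpen_ball.measurableSet).const_mul _).aemeasurable]
        congr 1 with k
        rw [lintegral_const_mul _ (hg.indicator Metric.isOpen_ball.measurableSet),
          lintegral_indicator Metric.isOpen_ball.measurableSet, setLAverage_eq,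
          ENNReal.div_eq_inv_mul]
        ring
    _ ≤ ∑' k : ℕ, 32 * 2⁻¹ ^ k * M := by
        gcongr with k
        exact hM' k
    _ = 64 * M := by
        rw [ENNReal.tsum_mul_right, ENNReal.tsum_mul_left, ENNReal.tsum_geometric,
          ENNReal.one_sub_inv_two, inv_inv]
        norm_num

/-- The Poisson extension of an `A₂` weight is bounded by its average over the arc seen from the
point. The tails are controlled by the maximal theorem for the indicator function of the arc, whose
maximal function has a square comparable to a multiple of the Poisson kernel. -/
theorem IsA2Density.ofReal_mul_lintegral_pKernel_le {w : Torus → ℝ≥0∞} {K : ℝ≥0}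
    (hw : IsA2Density w K) (hr : 0 ≤ r) (hr1 : r < 1) :
    ENNReal.ofReal (1 - r) * ∫⁻ u, ENNReal.ofReal (pKernel (r * bdryPoint y) (bdryPoint u))
        ∂arcMeasure.withDensity w ≤
      ((32 * (8 * (25 * K) * (K ^ 2 * (8 * (25 * K)))) : ℝ≥0) : ℝ≥0∞) *
        arcMeasure.withDensity w (Metric.ball y (1 - r)) := by
  have hρ : 0 < 1 - r := by linarith
  set L : Torus → ℝ := fun u => ‖1 - (r : ℂ) * bdryPoint y * (starRingEnd ℂ) (bdryPoint u)‖ with hL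
  have hLρ : ∀ u, 1 - r ≤ L u := fun u => one_sub_le_norm y u hr
  have hL0 : ∀ u, 0 < L u := fun u => hρ.trans_le (hLρ u)
  have hLm : Measurable L := by
    have := continuous_bdryPoint.measurable
    fun_prop
  set B := Metric.ball y (1 - r)
  have hB : MeasurableSet B := Metric.isOpen_ball.measurableSet
  have key : ∫⁻ u, ENNReal.ofReal ((1 - r) / (4 * L u)) ^ 2 ∂arcMeasure.withDensity w ≤
      ((8 * (25 * K) * (K ^ 2 * (8 * (25 * K))) : ℝ≥0) : ℝ≥0∞) *
        ∫⁻ u, B.indicator 1 u ^ 2 ∂arcMeasure.withDensity w := by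
    refine hw.lintegral_sq_le_of_le_tentMax_arcMeasure (T := Metric.ball) (R := 8)
      (fun _ _ _ _ => ball_subset_ball_five_mul)
      (fun _ _ => hw.withDensity_ball_five_mul_le _)
      (measurable_one.indicator hB) (by fun_prop) (Filter.Eventually.of_forall fun u => ?_)
    -- The ball `B(y, 4 L(u))` contains `u` and `B`, and its measure is at most
    -- `4 L(u) / (1 - r)` times that of `B`.
    have hd := dist_le_mul_norm y u hr hr1
    have hsub : B ⊆ Metric.ball y (4 * L u) :=
      Metric.ball_subset_ball (by linarith [hLρ u, hL0 u])
    refine le_trans ?_ (setLAverage_le_tentMax (x := y) (r := 4 * L u)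
      (by linarith [hL0 u]) (by linarith [norm_one_sub_le_two y u hr hr1]) ?_)
    · have h1 : ∫⁻ v in Metric.ball y (4 * L u), B.indicator 1 v ∂arcMeasure = arcMeasure B := by
        rw [lintegral_indicator_one hB, Measure.restrict_apply hB,
          Set.inter_eq_left.2 hsub]
      rw [setLAverage_eq, h1, ENNReal.le_div_iff_mul_le
        (Or.inl (arcMeasure_ball_ne_zero y (by linarith [hL0 u]))) (Or.inl (measure_ne_top _ _))]
      have h2 : 4 * L u = (4 * L u / (1 - r)) * (1 - r) := by field_simp
      have h3 : 1 ≤ 4 * L u / (1 - r) := by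
        rw [one_le_div hρ]
        linarith [hLρ u]
      calc ENNReal.ofReal ((1 - r) / (4 * L u)) * arcMeasure (Metric.ball y (4 * L u))
          ≤ ENNReal.ofReal ((1 - r) / (4 * L u)) *
              (ENNReal.ofReal (4 * L u / (1 - r)) * arcMeasure B) := by
            gcongr
            conv_lhs => rw [h2]
            exact arcMeasure_ball_mul_le y h3
        _ = arcMeasure B := by
            rw [← mul_assoc, ← ENNReal.ofReal_mul (by have := hL0 u; positivity)]
            have : (1 - r) / (4 * L u) * (4 * L u / (1 - r)) = 1 := by
              have := hL0 u
              field_simp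
            rw [this, ENNReal.ofReal_one, one_mul]
    · rw [Metric.mem_ball]
      nlinarith [Real.pi_lt_four, hL0 u]
  have hind : ∫⁻ u, B.indicator 1 u ^ 2 ∂arcMeasure.withDensity w =
      arcMeasure.withDensity w B := by
    rw [← lintegral_indicator_one hB]
    refine lintegral_congr fun u => ?_
    by_cases hu : u ∈ B <;> simp [hu]
  rw [hind] at key
  rw [← lintegral_const_mul' _ _ (by finiteness)]
  calc ∫⁻ u, ENNReal.ofReal (1 - r) * ENNReal.ofReal (pKernel (r * bdryPoint y) (bdryPoint u))
        ∂arcMeasure.withDensity w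
      ≤ ∫⁻ u, 32 * ENNReal.ofReal ((1 - r) / (4 * L u)) ^ 2 ∂arcMeasure.withDensity w := by
        refine lintegral_mono fun u => ?_
        have h32 : (32 : ℝ≥0∞) = ENNReal.ofReal 32 := by norm_num
        rw [← ENNReal.ofReal_mul hρ.le, ← ENNReal.ofReal_pow (by have := hL0 u; positivity), h32,
          ← ENNReal.ofReal_mul (by norm_num)]
        refine ENNReal.ofReal_le_ofReal ?_
        refine (mul_le_mul_of_nonneg_left (pKernel_le y u hr hr1) hρ.le).trans_eq ?_
        have := (hL0 u).ne'
        change (1 - r) * (2 * (1 - r) / L u ^ 2) = _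
        field_simp
        norm_num
    _ = 32 * ∫⁻ u, ENNReal.ofReal ((1 - r) / (4 * L u)) ^ 2 ∂arcMeasure.withDensity w :=
        lintegral_const_mul' _ _ (by finiteness)
    _ ≤ 32 * (((8 * (25 * K) * (K ^ 2 * (8 * (25 * K))) : ℝ≥0) : ℝ≥0∞) *
          arcMeasure.withDensity w B) := by gcongr
    _ = _ := by push_cast; ring

end Kernel

/-! ### The embedding, Poisson integrals and sectors -/

/-- The Poisson formula: a function continuous on the closed disk and analytic inside is the Poisson
extension of its boundary values. -/
theorem harmExt_comp_bdryPoint {g : ℂ → ℂ} (hg : DiffContOnCl ℂ g (Metric.ball 0 1)) {z : ℂ}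
    (hz : z ∈ disk) : harmExt (fun t => g (bdryPoint t)) z = g z := by
  rw [← hg.circleAverage_poissonKernel_smul hz, harmExt, AddCircle.integral_haarAddCircle,
    ← AddCircle.intervalIntegral_preimage (2 * Real.pi) 0, Real.circleAverage, zero_add]
  congr 1
  refine intervalIntegral.integral_congr fun θ _ => ?_
  have h : circleMap 0 1 θ = bdryPoint (θ : Torus) := by
    rw [bdryPoint_coe, circleMap]
    simp
  simp only [Pi.smul_apply', h]
  rw [pKernel_eq_poissonKernel _ _ (norm_bdryPoint _)]

theorem pKernel_nonneg {z : ℂ} (hz : z ∈ disk) (ζ : ℂ) : 0 ≤ pKernel z ζ := by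
  have h : ‖z‖ < 1 := by simpa [disk] using hz
  refine div_nonneg ?_ (by positivity)
  nlinarith [norm_nonneg z]

theorem exists_eq_mul_bdryPoint {z : ℂ} (hz : z ∈ disk) :
    ∃ (r : ℝ) (y : Torus), 0 ≤ r ∧ r < 1 ∧ z = r * bdryPoint y :=
  ⟨‖z‖, (z.arg : Torus), norm_nonneg z, by simpa [disk] using hz, by
    rw [bdryPoint_coe, Complex.norm_mul_exp_arg_mul_I]⟩

theorem measurable_pKernel_bdryPoint (z : ℂ) : Measurable fun t => pKernel z (bdryPoint t) := by
  have := continuous_bdryPoint.measurable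
  unfold pKernel
  fun_prop

theorem weightMeasure_eq {u : Torus → ℝ} {w : Torus → ℝ≥0∞}
    (hae : (fun t => ENNReal.ofReal (u t)) =ᵐ[arcMeasure] w) :
    weightMeasure u = arcMeasure.withDensity w :=
  withDensity_congr_ae hae

theorem ofReal_harmExt {u : Torus → ℝ} (hu : IsA2Weight u) {w : Torus → ℝ≥0∞} {K : ℝ≥0}
    (hw : IsA2Density w K) (hae : (fun t => ENNReal.ofReal (u t)) =ᵐ[arcMeasure] w) {z : ℂ}
    (hz : z ∈ disk) :
    ENNReal.ofReal (harmExt u z) =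
      ∫⁻ t, ENNReal.ofReal (pKernel z (bdryPoint t)) ∂arcMeasure.withDensity w := by
  have := hw.isFiniteMeasure
  have h1 : ∫⁻ t, ENNReal.ofReal (pKernel z (bdryPoint t)) ∂arcMeasure.withDensity w =
      ∫⁻ t, ENNReal.ofReal (pKernel z (bdryPoint t) • u t) ∂arcMeasure := by
    rw [hw.lintegral_withDensity]
    refine lintegral_congr_ae ?_
    filter_upwards [hae] with t ht
    rw [smul_eq_mul, ENNReal.ofReal_mul (pKernel_nonneg hz _), ht, mul_comm]
  have hfin : ∫⁻ t, ENNReal.ofReal (pKernel z (bdryPoint t)) ∂arcMeasure.withDensity w ≠ ∞ := by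
    obtain ⟨r, y, hr, hr1, rfl⟩ := exists_eq_mul_bdryPoint hz
    intro h
    have h2 := hw.ofReal_mul_lintegral_pKernel_le y hr hr1
    rw [h, ENNReal.mul_top (by simpa using hr1)] at h2
    exact (h2.trans_lt (by finiteness)).ne rfl
  -- Finiteness matters: a nonintegrable function has Bochner integral `0`.
  rw [harmExt, integral_eq_lintegral_of_nonneg_ae (f := fun t => pKernel z (bdryPoint t) • u t)
    (Filter.Eventually.of_forall fun t => mul_nonneg (pKernel_nonneg hz _) (hu.nonneg t))
    ((measurable_pKernel_bdryPoint z).aemeasurable.mul hu.aemeasurable).aestronglyMeasurable,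
    ← h1, ENNReal.ofReal_toReal hfin]

theorem ae_extMeasure_mem_disk (u : Torus → ℝ) (τ : Measure ℂ) :
    ∀ᵐ z ∂extMeasure u τ, z ∈ disk :=
  (withDensity_absolutelyContinuous _ _).ae_le (ae_restrict_mem Metric.isOpen_ball.measurableSet)

/-- The analytic function `ζ ↦ (1 - |z|²)^{1/2} / (1 - z̄ ζ)`, whose squared modulus is `P_z`. -/
def sqrtKernel (z ζ : ℂ) : ℂ :=
  (Real.sqrt (1 - ‖z‖ ^ 2) : ℂ) / (1 - (starRingEnd ℂ) z * ζ)

theorem enorm_sqrtKernel_sq {z : ℂ} (hz : z ∈ disk) (ζ : ℂ) :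
    ‖sqrtKernel z ζ‖ₑ ^ 2 = ENNReal.ofReal (pKernel z ζ) := by
  have hz1 : ‖z‖ < 1 := by simpa [disk] using hz
  have h : ‖1 - (starRingEnd ℂ) z * ζ‖ = ‖1 - z * (starRingEnd ℂ) ζ‖ := by
    rw [← Complex.norm_conj]
    simp
  rw [← ofReal_norm, ← ENNReal.ofReal_pow (norm_nonneg _), sqrtKernel, norm_div, h, div_pow,
    Complex.norm_real, Real.norm_eq_abs, sq_abs, Real.sq_sqrt (by nlinarith [norm_nonneg z]),
    pKernel]

theorem one_sub_conj_mul_ne_zero {z ζ : ℂ} (hz : z ∈ disk) (hζ : ‖ζ‖ ≤ 1) :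
    1 - (starRingEnd ℂ) z * ζ ≠ 0 := by
  have hz1 : ‖z‖ < 1 := by simpa [disk] using hz
  intro h
  have h1 : ‖(starRingEnd ℂ) z * ζ‖ = 1 := by rw [← sub_eq_zero.1 h, norm_one]
  rw [norm_mul, Complex.norm_conj] at h1
  nlinarith [norm_nonneg z, norm_nonneg ζ]

theorem diffContOnCl_sqrtKernel {z : ℂ} (hz : z ∈ disk) :
    DiffContOnCl ℂ (sqrtKernel z) (Metric.ball 0 1) := by
  refine DifferentiableOn.diffContOnCl_ball (U := Metric.closedBall 0 1) (fun ζ hζ => ?_) subset_rfl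
  refine DifferentiableAt.differentiableWithinAt ?_
  have := one_sub_conj_mul_ne_zero hz (mem_closedBall_zero_iff.1 hζ)
  unfold sqrtKernel
  fun_prop (disch := assumption)

theorem continuous_sqrtKernel_bdryPoint {z : ℂ} (hz : z ∈ disk) :
    Continuous fun t => sqrtKernel z (bdryPoint t) := by
  have := continuous_bdryPoint
  unfold sqrtKernel
  exact continuous_const.div (by fun_prop)
    fun t => one_sub_conj_mul_ne_zero hz (norm_bdryPoint t).le

/-- Testing the embedding on `sqrtKernel z`, for which both sides of the inequality can be
computed, bounds the Poisson integral of the measure with the same constant. -/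
theorem eLpNorm_pKernel_div_le {mu lam : Torus → ℝ} (hmu : IsA2Weight mu) {τ : Measure ℂ} {B : ℝ≥0}
    (hB : ∀ f : Torus → ℂ, MemLp f 2 (weightMeasure mu) →
      ∫⁻ z, ‖harmExt f z‖ₑ ^ 2 ∂(extMeasure lam τ) ≤
        B * ∫⁻ t, ‖f t‖ₑ ^ 2 ∂(weightMeasure mu)) {z : ℂ} (hz : z ∈ disk) :
    eLpNorm (pKernel z) 1 (extMeasure lam τ) / ENNReal.ofReal (harmExt mu z) ≤ B := by
  obtain ⟨w, K, hw, hae⟩ := hmu.exists_isA2Density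
  have := hw.isFiniteMeasure
  rw [weightMeasure_eq hae] at hB
  refine ENNReal.div_le_of_le_mul ?_
  have h := hB (fun t => sqrtKernel z (bdryPoint t))
    ((continuous_sqrtKernel_bdryPoint hz).memLp_of_hasCompactSupport
      (HasCompactSupport.of_compactSpace _))
  simp_rw [enorm_sqrtKernel_sq hz] at h
  rw [← ofReal_harmExt hmu hw hae hz] at h
  refine le_trans (le_of_eq ?_) h
  rw [eLpNorm_one_eq_lintegral_enorm]
  refine lintegral_congr_ae ?_
  filter_upwards [ae_extMeasure_mem_disk lam τ] with ζ hζ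
  rw [harmExt_comp_bdryPoint (diffContOnCl_sqrtKernel hz) hζ, enorm_sqrtKernel_sq hz,
    Real.enorm_of_nonneg (pKernel_nonneg hz ζ)]

theorem inv_le_pKernel_of_mem_sector {θ₀ h : ℝ} (h0 : 0 < h) (h1 : h ≤ 1) {ζ : ℂ}
    (hζ : ζ ∈ sector θ₀ h) :
    (9 * h)⁻¹ ≤ pKernel (((1 - h : ℝ) : ℂ) * bdryPoint (θ₀ : Torus)) ζ := by
  obtain ⟨r, θ, hr, hr1, hθ, rfl⟩ := hζ
  set c : ℝ := (1 - h) * r with hc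
  have hc0 : 0 ≤ c := by nlinarith
  have hc1 : c ≤ 1 := by nlinarith
  have hmul : ((1 - h : ℝ) : ℂ) * bdryPoint (θ₀ : Torus) *
      (starRingEnd ℂ) (r * Complex.exp (θ * Complex.I)) =
        c * Complex.exp (((θ₀ - θ : ℝ) : ℂ) * Complex.I) := by
    rw [bdryPoint_coe, map_mul, Complex.conj_ofReal, ← Complex.exp_conj, map_mul,
      Complex.conj_ofReal, Complex.conj_I, hc]
    have h2 : ((θ₀ - θ : ℝ) : ℂ) * Complex.I = θ₀ * Complex.I + θ * -Complex.I := by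
      push_cast
      ring
    rw [h2, Complex.exp_add]
    push_cast
    ring
  set e := Complex.exp (((θ₀ - θ : ℝ) : ℂ) * Complex.I) with he
  have hle : ‖1 - (c : ℂ) * e‖ ≤ 3 * h := by
    have h2 : 1 - (c : ℂ) * e = ((1 - c : ℝ) : ℂ) + c * -(e - 1) := by push_cast; ring
    rw [h2]
    refine (norm_add_le _ _).trans ?_
    rw [norm_mul, norm_neg, Complex.norm_real, Complex.norm_real, Real.norm_eq_abs,
      Real.norm_eq_abs, abs_of_nonneg hc0, abs_of_nonneg (by linarith)]
    have h3 : ‖e - 1‖ ≤ h := (norm_exp_sub_one_le _).trans (by rwa [abs_sub_comm])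
    have h4 : 1 - c ≤ 2 * h := by rw [hc]; nlinarith
    have h5 : c * ‖e - 1‖ ≤ 1 * h := mul_le_mul hc1 h3 (norm_nonneg _) zero_le_one
    linarith
  have hne : 0 < ‖1 - (c : ℂ) * e‖ := by
    have h2 := norm_sub_norm_le (1 : ℂ) ((c : ℂ) * e)
    rw [norm_one, norm_mul, he, Complex.norm_exp_ofReal_mul_I, Complex.norm_real,
      Real.norm_eq_abs, abs_of_nonneg hc0] at h2
    have : c < 1 := by rw [hc]; nlinarith
    linarith
  rw [pKernel, hmul, norm_mul, norm_bdryPoint, Complex.norm_real, Real.norm_eq_abs,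
    abs_of_nonneg (by linarith), mul_one, le_div_iff₀ (by positivity),
    inv_mul_le_iff₀ (by positivity)]
  have h2 := pow_le_pow_left₀ hne.le hle 2
  nlinarith

theorem mem_disk_mul_bdryPoint {r : ℝ} (hr : 0 ≤ r) (hr1 : r < 1) (y : Torus) :
    (r : ℂ) * bdryPoint y ∈ disk := by
  simpa [disk, norm_bdryPoint, abs_of_nonneg hr] using hr1

/-- A bound for the Poisson integrals gives the sector condition: for
`z = (1 - h) e^{iθ₀}` the kernel `P_z` is at least `1 / (9 h)` on the sector, and `mu(z)` is at most
a multiple of the average of `mu` over the arc. -/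
theorem exists_sector_bound {mu lam : Torus → ℝ} (hmu : IsA2Weight mu) {τ : Measure ℂ}
    (hsup : (⨆ z ∈ disk, eLpNorm (pKernel z) 1 (extMeasure lam τ) /
      ENNReal.ofReal (harmExt mu z)) < ∞) :
    ∃ D : ℝ≥0, ∀ θ₀ h : ℝ, 0 < h → h ≤ 1 →
      extMeasure lam τ (sector θ₀ h) / weightMeasure mu (arc θ₀ h) < D := by
  obtain ⟨w, K, hw, hae⟩ := hmu.exists_isA2Density
  have := hw.isFiniteMeasure
  rw [weightMeasure_eq hae]
  set C := ⨆ z ∈ disk, eLpNorm (pKernel z) 1 (extMeasure lam τ) / ENNReal.ofReal (harmExt mu z)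
    with hC
  obtain ⟨C', hC'⟩ : ∃ C' : ℝ≥0, ∀ (y : Torus) (r : ℝ), 0 ≤ r → r < 1 →
      ENNReal.ofReal (1 - r) * ∫⁻ u, ENNReal.ofReal (pKernel (r * bdryPoint y) (bdryPoint u))
        ∂arcMeasure.withDensity w ≤ C' * arcMeasure.withDensity w (Metric.ball y (1 - r)) :=
    ⟨_, fun y r => hw.ofReal_mul_lintegral_pKernel_le y⟩
  have hfin : 9 * (C * C') ≠ ∞ := by finiteness
  refine ⟨(9 * (C * C')).toNNReal + 1, fun θ₀ h h0 h1 => ?_⟩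
  rw [ENNReal.coe_add, ENNReal.coe_toNNReal hfin, ENNReal.coe_one]
  refine lt_of_le_of_lt (ENNReal.div_le_of_le_mul ?_) (ENNReal.lt_add_right hfin one_ne_zero)
  set ν := extMeasure lam τ
  set z : ℂ := ((1 - h : ℝ) : ℂ) * bdryPoint (θ₀ : Torus) with hz
  have hzd : z ∈ disk := mem_disk_mul_bdryPoint (by linarith) (by linarith) _
  have hP : eLpNorm (pKernel z) 1 ν ≤ C * ENNReal.ofReal (harmExt mu z) := by
    rw [← ENNReal.div_le_iff_le_mul (Or.inr hsup.ne) (Or.inl ENNReal.ofReal_ne_top)]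
    exact le_iSup₂_of_le z hzd le_rfl
  have hS : ENNReal.ofReal (9 * h)⁻¹ * ν (sector θ₀ h) ≤ eLpNorm (pKernel z) 1 ν := by
    rw [eLpNorm_one_eq_lintegral_enorm]
    have hm : Measurable (pKernel z) := by
      unfold pKernel
      fun_prop
    refine le_trans ?_ (mul_meas_ge_le_lintegral hm.enorm (ENNReal.ofReal (9 * h)⁻¹))
    gcongr
    intro ζ hζ
    rw [Set.mem_ofPred_eq, Real.enorm_of_nonneg (pKernel_nonneg hzd ζ)]
    exact ENNReal.ofReal_le_ofReal (inv_le_pKernel_of_mem_sector h0 h1 hζ)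
  have hmuz := hC' (θ₀ : Torus) (1 - h) (by linarith) (by linarith)
  rw [← hz, ← ofReal_harmExt hmu hw hae hzd, sub_sub_cancel] at hmuz
  have hsub : Metric.ball (θ₀ : Torus) h ⊆ arc θ₀ h :=
    Metric.ball_subset_closedBall.trans
      (Metric.closedBall_subset_closedBall (by nlinarith [Real.pi_gt_three]))
  calc ν (sector θ₀ h)
      = ENNReal.ofReal (9 * h) * (ENNReal.ofReal (9 * h)⁻¹ * ν (sector θ₀ h)) := by
        rw [← mul_assoc, ← ENNReal.ofReal_mul (by positivity), mul_inv_cancel₀ (by positivity),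
          ENNReal.ofReal_one, one_mul]
    _ ≤ ENNReal.ofReal (9 * h) * (C * ENNReal.ofReal (harmExt mu z)) := by
        gcongr _ * ?_
        exact hS.trans hP
    _ = 9 * C * (ENNReal.ofReal h * ENNReal.ofReal (harmExt mu z)) := by
        rw [ENNReal.ofReal_mul (by norm_num), ENNReal.ofReal_ofNat]
        ring
    _ ≤ 9 * C * (C' * arcMeasure.withDensity w (arc θ₀ h)) := by
        gcongr 9 * C * ?_
        exact hmuz.trans (by gcongr)
    _ = _ := by ring

/-- The tent over the ball `B(x, r)` of the circle: the points of the disk at distance at most `r`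
from the circle whose radial projection lies in the ball. The centre of the disk projects to every
point. -/
def tent (x : Torus) (r : ℝ) : Set ℂ :=
  {z | ∃ (s : ℝ) (y : Torus), 0 ≤ s ∧ s < 1 ∧ 1 - s ≤ r ∧ y ∈ Metric.ball x r ∧
    z = s * bdryPoint y}

theorem tent_subset_tent_five_mul {x x' : Torus} {r r' : ℝ}
    (h : (Metric.ball x r ∩ Metric.ball x' r').Nonempty) (hr : r' ≤ 2 * r) :
    tent x' r' ⊆ tent x (5 * r) := by
  rintro z ⟨s, y, hs, hs1, hsr, hy, rfl⟩
  exact ⟨s, y, hs, hs1, by linarith, ball_subset_ball_five_mul h hr hy, rfl⟩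

theorem tent_subset_sector (θ₀ r : ℝ) : tent (θ₀ : Torus) r ⊆ sector θ₀ r := by
  rintro z ⟨s, y, -, hs1, hsr, hy, rfl⟩
  obtain ⟨φ, -, hφ, hn⟩ := exists_coe_eq_and_norm_eq_abs (y - (θ₀ : Torus))
  refine ⟨s, θ₀ + φ, by linarith, hs1, ?_, ?_⟩
  · rw [add_sub_cancel_left, ← hn, ← dist_eq_norm]
    exact (Metric.mem_ball.1 hy).le
  · rw [← bdryPoint_coe, AddCircle.coe_add, hφ, add_sub_cancel]

theorem tent_subset_iUnion_sector (x : Torus) (r : ℝ) :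
    tent x r ⊆ ⋃ i : Fin 4, sector (2 * (i : ℕ) - 3) 1 := by
  rintro z ⟨s, y, hs, hs1, -, -, rfl⟩
  obtain ⟨φ, hφ, rfl, -⟩ := exists_coe_eq_and_norm_eq_abs y
  have hp := Real.pi_lt_four
  rw [abs_le] at hφ
  obtain ⟨i, hi⟩ : ∃ i : Fin 4, |φ - (2 * (i : ℕ) - 3)| ≤ 1 := by
    rcases le_or_gt φ 0 with h | h
    · rcases le_or_gt φ (-2) with h' | h'
      · exact ⟨0, abs_le.2 ⟨by norm_num; linarith, by norm_num; linarith⟩⟩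
      · exact ⟨1, abs_le.2 ⟨by norm_num; linarith, by norm_num; linarith⟩⟩
    · rcases le_or_gt φ 2 with h' | h'
      · exact ⟨2, abs_le.2 ⟨by norm_num; linarith, by norm_num; linarith⟩⟩
      · exact ⟨3, abs_le.2 ⟨by norm_num; linarith, by norm_num; linarith⟩⟩
  exact Set.mem_iUnion.2 ⟨i, s, φ, by linarith, hs1, hi, by rw [bdryPoint_coe]⟩

/-- Under the sector condition the measure of a tent is controlled by the weight of the ball; tents
over balls of radius more than `1` are covered by four sectors. -/
theorem measure_tent_le {w : Torus → ℝ≥0∞} {K : ℝ≥0} (hw : IsA2Density w K) {ν : Measure ℂ}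
    {D : ℝ≥0} (hD : ∀ θ₀ h : ℝ, 0 < h → h ≤ 1 →
      ν (sector θ₀ h) ≤ D * arcMeasure.withDensity w (arc θ₀ h)) (x : Torus) {r : ℝ} (hr : 0 < r) :
    ν (tent x (5 * r)) ≤ ((4 * D * (400 * K) : ℝ≥0) : ℝ≥0∞) *
      arcMeasure.withDensity w (Metric.ball x r) := by
  have hp := Real.pi_lt_four
  have hp3 := Real.pi_gt_three
  have h1 : ν (tent x (5 * r)) ≤
      4 * D * arcMeasure.withDensity w (Metric.ball x (20 * r)) := by
    rcases le_or_gt (5 * r) 1 with h | h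
    · obtain ⟨θ, rfl⟩ := QuotientAddGroup.mk_surjective x
      calc ν (tent (θ : Torus) (5 * r)) ≤ ν (sector θ (5 * r)) :=
            measure_mono (tent_subset_sector θ (5 * r))
        _ ≤ D * arcMeasure.withDensity w (arc θ (5 * r)) := hD _ _ (by linarith) h
        _ ≤ D * arcMeasure.withDensity w (Metric.ball (θ : Torus) (20 * r)) := by
            gcongr
            exact Metric.closedBall_subset_ball (by nlinarith)
        _ ≤ 4 * (D * arcMeasure.withDensity w (Metric.ball (θ : Torus) (20 * r))) :=
            le_mul_of_one_le_left zero_le (by norm_num)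
        _ = _ := by rw [mul_assoc]
    · -- The ball of radius `20 r > π` is the whole circle.
      rw [ball_eq_univ x (show Real.pi < 20 * r by linarith)]
      calc ν (tent x (5 * r)) ≤ ∑ i : Fin 4, ν (sector (2 * (i : ℕ) - 3) 1) :=
            (measure_mono (tent_subset_iUnion_sector x _)).trans (measure_iUnion_fintype_le _ _)
        _ ≤ ∑ _i : Fin 4, D * arcMeasure.withDensity w Set.univ := by
            gcongr with i
            exact (hD _ _ one_pos le_rfl).trans (by gcongr; exact Set.subset_univ _)
        _ = _ := by
            rw [Finset.sum_const, Finset.card_univ, Fintype.card_fin, nsmul_eq_mul, mul_assoc]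
            rfl
  refine h1.trans ?_
  calc 4 * D * arcMeasure.withDensity w (Metric.ball x (20 * r))
      ≤ 4 * D * (ENNReal.ofReal 20 ^ 2 * K * arcMeasure.withDensity w (Metric.ball x r)) := by
        gcongr
        exact hw.withDensity_ball_mul_le x (by norm_num) hr
    _ = _ := by
        push_cast
        rw [ENNReal.ofReal_ofNat, ← mul_assoc]
        norm_num

/-- The Carleson embedding: the Poisson extension is bounded by the maximal function over tents. -/
theorem exists_embedding_bound {mu lam : Torus → ℝ} (hmu : IsA2Weight mu) {τ : Measure ℂ} {D : ℝ≥0}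
    (hD : ∀ θ₀ h : ℝ, 0 < h → h ≤ 1 →
      extMeasure lam τ (sector θ₀ h) / weightMeasure mu (arc θ₀ h) < D) :
    ∃ B : ℝ≥0, ∀ f : Torus → ℂ, MemLp f 2 (weightMeasure mu) →
      ∫⁻ z, ‖harmExt f z‖ₑ ^ 2 ∂(extMeasure lam τ) ≤
        B * ∫⁻ t, ‖f t‖ₑ ^ 2 ∂(weightMeasure mu) := by
  obtain ⟨w, K, hw, hae⟩ := hmu.exists_isA2Density
  have := hw.isFiniteMeasure
  rw [weightMeasure_eq hae] at *
  set ν := extMeasure lam τ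
  have hD' : ∀ θ₀ h : ℝ, 0 < h → h ≤ 1 →
      ν (sector θ₀ h) ≤ D * arcMeasure.withDensity w (arc θ₀ h) := by
    intro θ₀ h h0 h1
    have h2 := hD θ₀ h h0 h1
    exact (ENNReal.div_le_iff_le_mul (Or.inr ENNReal.coe_ne_top)
      (Or.inl (measure_ne_top _ _))).1 h2.le
  set C : ℝ≥0 := 8 * (4 * D * (400 * K)) * (K ^ 2 * (8 * (25 * K)))
  refine ⟨64 ^ 2 * C, fun f hf => ?_⟩
  -- `W` and `m` have the same null sets, so `f` may be replaced by a measurable representative.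
  have hac : arcMeasure ≪ arcMeasure.withDensity w :=
    withDensity_absolutelyContinuous' hw.measurable.aemeasurable
      (Filter.Eventually.of_forall hw.ne_zero)
  have hfW := hf.aestronglyMeasurable
  set f' := hfW.mk f with hf'
  set g : Torus → ℝ≥0∞ := fun t => ‖f' t‖ₑ with hg
  have hgm : Measurable g := hfW.stronglyMeasurable_mk.enorm
  have hfg : ∀ᵐ t ∂arcMeasure, ‖f t‖ₑ = g t := by
    filter_upwards [hac.ae_le hfW.ae_eq_mk] with t ht
    rw [hg, ht]
  set F : ℂ → ℝ≥0∞ := fun z =>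
    ∫⁻ t, ENNReal.ofReal (pKernel z (bdryPoint t)) * g t ∂arcMeasure with hF
  have hFm : Measurable F := by
    refine Measurable.lintegral_prod_right' (f := fun p : ℂ × Torus =>
      ENNReal.ofReal (pKernel p.1 (bdryPoint p.2)) * g p.2) ?_
    exact (measurable_pKernel.comp (measurable_fst.prodMk
      (continuous_bdryPoint.measurable.comp measurable_snd))).ennreal_ofReal.mul
        (hgm.comp measurable_snd)
  have hle : ∀ z ∈ disk, ‖harmExt f z‖ₑ ≤ F z := by
    intro z hz
    refine (enorm_integral_le_lintegral_enorm _).trans (le_of_eq (lintegral_congr_ae ?_))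
    filter_upwards [hfg] with t ht
    rw [enorm_smul, ht, Real.enorm_of_nonneg (pKernel_nonneg hz _)]
  have hmax : ∀ z ∈ disk, 64⁻¹ * F z ≤ tentMax arcMeasure tent 4 g z := by
    intro z hz
    obtain ⟨r, y, hr, hr1, rfl⟩ := exists_eq_mul_bdryPoint hz
    rw [ENNReal.inv_mul_le_iff (by norm_num) (by norm_num)]
    refine lintegral_pKernel_mul_le y hr hr1 hgm fun s hs hs4 => ?_
    have hs0 : 0 < s := by linarith
    exact setLAverage_le_tentMax hs0 hs4 ⟨r, y, hr, hr1, hs, Metric.mem_ball_self hs0, rfl⟩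
  have key : ∫⁻ z, (64⁻¹ * F z) ^ 2 ∂ν ≤ C * ∫⁻ t, g t ^ 2 ∂arcMeasure.withDensity w :=
    hw.lintegral_sq_le_of_le_tentMax_arcMeasure (T := tent) (R := 4)
      (fun _ _ _ _ => tent_subset_tent_five_mul) (fun x _ => measure_tent_le hw hD' x) hgm
      (hFm.const_mul _) ((ae_extMeasure_mem_disk lam τ).mono hmax)
  calc ∫⁻ z, ‖harmExt f z‖ₑ ^ 2 ∂ν ≤ ∫⁻ z, 64 ^ 2 * (64⁻¹ * F z) ^ 2 ∂ν := by
        refine lintegral_mono_ae ?_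
        filter_upwards [ae_extMeasure_mem_disk lam τ] with z hz
        rw [← mul_pow, ← mul_assoc, ENNReal.mul_inv_cancel (by norm_num) (by norm_num), one_mul]
        exact pow_le_pow_left' (hle z hz) 2
    _ = 64 ^ 2 * ∫⁻ z, (64⁻¹ * F z) ^ 2 ∂ν := lintegral_const_mul' _ _ (by finiteness)
    _ ≤ 64 ^ 2 * (C * ∫⁻ t, g t ^ 2 ∂arcMeasure.withDensity w) := by gcongr
    _ = _ := by
        have h64 : ((64 ^ 2 * C : ℝ≥0) : ℝ≥0∞) = 64 ^ 2 * (C : ℝ≥0∞) := by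
          rw [ENNReal.coe_mul, ENNReal.coe_pow, ENNReal.coe_ofNat]
        rw [h64, mul_assoc]
        congr 2
        refine lintegral_congr_ae ?_
        filter_upwards [hfW.ae_eq_mk] with t ht
        rw [hg, ht]

end TwoWeight

end

theorem theoremT (mu lam : TwoWeight.Torus → ℝ)
    (hmu : TwoWeight.IsA2Weight mu) (hlam : TwoWeight.IsA2Weight lam) (τ : Measure ℂ) :
    List.TFAE [
      ∃ B : ℝ≥0, ∀ f : TwoWeight.Torus → ℂ, MemLp f 2 (TwoWeight.weightMeasure mu) →
        ∫⁻ z, ‖TwoWeight.harmExt f z‖ₑ ^ 2 ∂(TwoWeight.extMeasure lam τ) ≤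
          B * ∫⁻ t, ‖f t‖ₑ ^ 2 ∂(TwoWeight.weightMeasure mu),
      (⨆ z ∈ TwoWeight.disk,
        eLpNorm (TwoWeight.pKernel z) 1 (TwoWeight.extMeasure lam τ) /
          ENNReal.ofReal (TwoWeight.harmExt mu z)) < ∞,
      ∃ D : ℝ≥0, ∀ θ₀ h : ℝ, 0 < h → h ≤ 1 →
        TwoWeight.extMeasure lam τ (TwoWeight.sector θ₀ h) /
          TwoWeight.weightMeasure mu (TwoWeight.arc θ₀ h) < D] := by
  tfae_have 1 → 2 := by
    rintro ⟨B, hB⟩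
    refine lt_of_le_of_lt (iSup₂_le fun z hz => ?_) (ENNReal.coe_lt_top (r := B))
    exact TwoWeight.eLpNorm_pKernel_div_le hmu hB hz
  tfae_have 2 → 3 := TwoWeight.exists_sector_bound hmu
  tfae_have 3 → 1 := fun ⟨_, hD⟩ => TwoWeight.exists_embedding_bound hmu hD
  tfae_finish
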